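/- **Theorem 1.1.** Let $N\ge 2$ be an integer, put $\lambda_*:=-(N-2)^2/4$ and, for $\lambda\ge\lambda_*$, let $$A^\pm(\lambda):=\frac{-(N-2)\pm\sqrt{(N-2)^2+4\lambda}}{2}.$$ Let $V$ be a continuous real function on $(0,\infty)$ such that, for some $\theta>0$ and some $\lambda_1,\lambda_2\in[\lambda_*,\infty)$, $$\lim_{r\to0}r^{-\theta}\,|r^2V(r)-\lambda_1|=0,\qquad \lim_{r\to\infty}r^{\theta}\,|r^2V(r)-\lambda_2|=0 .$$ For a real function $Q$ on $\mathbf R^N$ that is continuous on $\mathbf R^N\setminus\{0\}$, the operator $-\Delta+Q$ is called *nonnegative* if $\int_{\mathbf R^N}\left[|\nabla\phi|^2+Q\phi^2\right]dx\ge0$ for all $\phi\in C_0^\infty(\mathbf R^N\setminus\{0\})$; *subcritical* if for every $W\in C_0^\infty(\mathbf R^N)$ the operator $-\Delta+Q-\epsilon W$ is nonnegative for all small enough $\epsilon>0$; *critical* if it is nonnegative but not subcritical; *supercritical* if it is not nonnegative. Here $C_0^\infty$ denotes smooth real functions with compact support. Put $H:=-\Delta+V(|x|)$. Write $f\sim g$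 if $f/g\to1$. Solutions of (O) are understood to be of class $C^2$ on $(0,\infty)$ and real valued. 1. There exists a unique solution $U$ of $$\text{(O)}\qquad U''+\frac{N-1}{r}U'-V(r)U=0\quad\text{in }(0,\infty)$$ with $U(r)\sim r^{A^+(\lambda_1)}$ as $r\to0$. 2. Let $w$ be a solution of (O) such that, as $r\to0$, $w(r)=o(r^{A^-(\lambda_1)})$ if $\lambda_1>\lambda_*$, and $w(r)=o(r^{-\frac{N-2}{2}}|\log r|)$ if $\lambda_1=\lambda_*$. Then there is a constant $c$ such that $w=cU$ on $(0,\infty)$. 3. Assume that $H$ is nonnegative. Then $U>0$ on $(0,\infty)$, and there is a constant $c_*>0$ such that, as $r\to\infty$, - (a) $U(r)\sim c_*r^{A^+(\lambda_2)}$ if $H$ is subcritical and $\lambda_2>\lambda_*$; - (b) $U(r)\sim c_*r^{A^-(\lambda_2)}$ if $H$ is critical and $\lambda_2>\lambda_*$; - (c) $U(r)\sim c_*r^{-\frac{N-2}{2}}\log r$ if $H$ is subcritical and $\lambda_2=\lambda_*$; - (d) $U(r)\sim c_*r^{-\frac{N-2}{2}}$ if $H$ is critical and $\lambda_2=\lambda_*$.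 4. Assume that $H$ is subcritical. Let $W$ be a continuous function with compact support on $[0,\infty)$ such that $W\ge0$ and $W\not\equiv0$, and set $H_\mu:=-\Delta+V(|x|)-\mu W(|x|)$ for $\mu\in\mathbf R$. Then there exists $\mu_*>0$ such that - (a) $H_\mu$ is subcritical if $\mu<\mu_*$; - (b) $H_\mu$ is critical if $\mu=\mu_*$; - (c) $H_\mu$ is supercritical if $\mu>\mu_*$. -/

import Mathlib

open Filter Topology Set MeasureTheory
open scoped ContDiff

/-- The Hardy constant `λ_* = -(N-2)²/4`. -/
noncomputable def lambdaStar (N : ℕ) : ℝ := -((N : ℝ) - 2) ^ 2 / 4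

/-- The larger root `A⁺(l)` of `α² + (N-2) α - l = 0`, for `l ≥ λ_*`. -/
noncomputable def rootPlus (N : ℕ) (l : ℝ) : ℝ :=
  (-((N : ℝ) - 2) + Real.sqrt (((N : ℝ) - 2) ^ 2 + 4 * l)) / 2

/-- The smaller root `A⁻(l)` of `α² + (N-2) α - l = 0`, for `l ≥ λ_*`. -/
noncomputable def rootMinus (N : ℕ) (l : ℝ) : ℝ :=
  (-((N : ℝ) - 2) - Real.sqrt (((N : ℝ) - 2) ^ 2 + 4 * l)) / 2

/-- `u` is a (classical, i.e. `C²`) solution of `u'' + (N-1)/r u' - V(r) u = 0` in `(0,∞)`.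
Only the values of `u` and `V` on `(0,∞)` matter. -/
def IsRadialSolution (N : ℕ) (V u : ℝ → ℝ) : Prop :=
  ContDiffOn ℝ 2 u (Ioi 0) ∧
    ∀ r : ℝ, 0 < r → deriv (deriv u) r + ((N : ℝ) - 1) / r * deriv u r - V r * u r = 0

/-- `-Δ + Q` is nonnegative on `ℝ^N`: `∫ |∇φ|² + Q φ² dx ≥ 0` for all
`φ ∈ C_0^∞(ℝ^N ∖ {0})`. It is used for potentials `Q` that are continuous away from the origin,
for which the integrand is continuous with compact support, hence integrable. -/
def IsNonnegSchrodinger {N : ℕ} (Q : EuclideanSpace ℝ (Fin N) → ℝ) : Prop :=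
  ∀ φ : EuclideanSpace ℝ (Fin N) → ℝ,
    ContDiff ℝ ∞ φ → HasCompactSupport φ → tsupport φ ⊆ {0}ᶜ →
      0 ≤ ∫ x, (‖gradient φ x‖ ^ 2 + Q x * φ x ^ 2)

/-- `-Δ + Q` is subcritical: for every `W ∈ C_0^∞(ℝ^N)`, the operator `-Δ + Q - ε W` is
nonnegative for all small enough `ε > 0`. -/
def IsSubcritical {N : ℕ} (Q : EuclideanSpace ℝ (Fin N) → ℝ) : Prop :=
  ∀ W : EuclideanSpace ℝ (Fin N) → ℝ, ContDiff ℝ ∞ W → HasCompactSupport W →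
    ∃ ε₀ : ℝ, 0 < ε₀ ∧ ∀ ε : ℝ, 0 < ε → ε < ε₀ →
      IsNonnegSchrodinger (fun x => Q x - ε * W x)

/-- `-Δ + Q` is critical: it is nonnegative but not subcritical. -/
def IsCritical {N : ℕ} (Q : EuclideanSpace ℝ (Fin N) → ℝ) : Prop :=
  IsNonnegSchrodinger Q ∧ ¬ IsSubcritical Q

/-- `-Δ + Q` is supercritical: it is not nonnegative. -/
def IsSupercritical {N : ℕ} (Q : EuclideanSpace ℝ (Fin N) → ℝ) : Prop :=
  ¬ IsNonnegSchrodinger Q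

/-- The radial potential `x ↦ V(|x|)` on `ℝ^N`. -/
noncomputable def radialPotential (N : ℕ) (V : ℝ → ℝ) : EuclideanSpace ℝ (Fin N) → ℝ :=
  fun x => V ‖x‖

/-! The substitution u(r) = r^{-(N-2)/2} v(log r) turns (O) into v'' = q v on the whole line. Here q
tends exponentially fast to κ₁² at -∞ and to κ₂² at +∞, where A^±(λᵢ) = -(N-2)/2 ± κᵢ. At each end a
fixed point argument yields a recessive solution, asymptotic to e^{-κ|t|}. Every other solution is
compared with it through the constant Wronskian: (u/v)' = W/v², so by l'Hôpital u is asymptotic to W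
times the dominant profile, e^{κ|t|}/(2κ) or |t|. The function U is the recessive solution z(-t) at
-∞. A solution that is o(dominant) there has zero Wronskian with it, hence is a multiple of it. This
gives existence, uniqueness and (2).

For (3), nonnegativity of H passes to the form ∫ φ'² + qφ² by radial test functions. A recessive
solution then has no zero: if it vanished at t₀, its truncation there would have arbitrarily small
energy, and smoothing the corner would make the energy negative
(`IsLineSolution.deriv_eq_zero_of_nonneg`). So U and the recessive solution v at +∞ are positive,
and the alternative subcritical/critical is read off their Wronskian W₀. If W₀ = 0, then U
corresponds to a solution bounded at both ends; cutting it off on long intervals costs energy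
O(1/n), so no potential well can be subtracted and H is not subcritical. If W₀ ≠ 0, averaging the
logarithmic derivatives of the two positive solutions gives a Riccati supersolution with a strict
gain W₀²/(4v²u²). The associated vector field on ℝ^N proves H - εW nonnegative for small ε. The
behaviour of U at infinity follows from whether W₀ vanishes.

Part (4) needs no differential equation: the admissible μ are bounded above by a Rayleigh quotient,
and the supremum is analysed by convexity and monotonicity of the form. -/

/-- The pair `(v, v')` solves `v'' = q v` on the whole line. -/
def IsLineSolution (q v v' : ℝ → ℝ) : Prop :=
  (∀ t, HasDerivAt v (v' t) t) ∧ ∀ t, HasDerivAt v' (q t * v t) t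

/-! ### Recessive solutions by a weighted fixed point -/

theorem hasDerivAt_integral_Ioi {f : ℝ → ℝ} (hf : Continuous f)
    (hi : ∀ a, IntegrableOn f (Ioi a)) (t : ℝ) :
    HasDerivAt (fun t => ∫ s in Ioi t, f s) (-f t) t := by
  have h : ∀ t, ∫ s in Ioi t, f s = (∫ s in Ioi 0, f s) - ∫ s in (0:ℝ)..t, f s := by
    intro t
    rw [← intervalIntegral.integral_interval_add_Ioi (hi 0) (hi t)]
    ring
  rw [funext h]
  exact (intervalIntegral.integral_hasDerivAt_right (hf.intervalIntegrable _ _)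
    (hf.stronglyMeasurableAtFilter _ _) hf.continuousAt).const_sub _

/-- The weight `e^{-θt} exp(L e^{-θt})`. -/
noncomputable def decayWeight (θ L t : ℝ) : ℝ :=
  Real.exp (-θ * t) * Real.exp (L * Real.exp (-θ * t))

theorem decayWeight_pos (θ L t : ℝ) : 0 < decayWeight θ L t := by
  unfold decayWeight; positivity

theorem continuous_decayWeight (θ L : ℝ) : Continuous (decayWeight θ L) := by
  unfold decayWeight; fun_prop


theorem tendsto_exp_neg_mul {θ : ℝ} (hθ : 0 < θ) :
    Tendsto (fun t : ℝ => Real.exp (-θ * t)) atTop (𝓝 0) :=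
  Real.tendsto_exp_atBot.comp (tendsto_id.const_mul_atTop_of_neg (by linarith))

theorem tendsto_decayWeight {θ : ℝ} (hθ : 0 < θ) (L : ℝ) :
    Tendsto (decayWeight θ L) atTop (𝓝 0) := by
  have h := tendsto_exp_neg_mul hθ
  have := h.mul ((Real.continuous_exp.tendsto _).comp (h.const_mul L))
  rw [zero_mul] at this
  exact this

theorem integral_decayWeight {θ L : ℝ} (hθ : 0 < θ) (hL : 0 < L) (t : ℝ) :
    IntegrableOn (decayWeight θ L) (Ioi t) ∧
      ∫ s in Ioi t, decayWeight θ L s = (Real.exp (L * Real.exp (-θ * t)) - 1) / (θ * L) := by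
  have hd : ∀ s ∈ Ici t, HasDerivAt (fun s => -Real.exp (L * Real.exp (-θ * s)) / (θ * L))
      (decayWeight θ L s) s := by
    intro s _
    have h1 : HasDerivAt (fun s : ℝ => -θ * s) (-θ) s := by
      simpa using (hasDerivAt_id s).const_mul (-θ)
    refine (((h1.exp.const_mul L).exp.neg).div_const (θ * L)).congr_deriv ?_
    unfold decayWeight
    field_simp
  have hl : Tendsto (fun s => -Real.exp (L * Real.exp (-θ * s)) / (θ * L)) atTop
      (𝓝 (-1 / (θ * L))) := by
    have h := tendsto_exp_neg_mul hθ
    have := (((Real.continuous_exp.tendsto _).comp (h.const_mul L)).neg).div_const (θ * L)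
    simpa using this
  refine ⟨integrableOn_Ioi_deriv_of_nonneg' hd (fun s _ => (decayWeight_pos θ L s).le) hl, ?_⟩
  rw [integral_Ioi_of_hasDerivAt_of_nonneg' hd (fun s _ => (decayWeight_pos θ L s).le) hl]
  ring

/-- The weight is an exact derivative, so its tail is (e^{Lx} - 1)/(θL) with x = e^{-θt}. The first
bound keeps the factor 1/L, the source of the contraction; the second uses e^{Lx} - 1 ≤ Lx e^{Lx} to
return a multiple of the weight itself. -/
theorem integral_Ioi_bound {θ L : ℝ} (hθ : 0 < θ) (hL : 0 < L) {f : ℝ → ℝ} (hf : Continuous f)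
    {M t : ℝ} (hM : 0 ≤ M) (h : ∀ s, t < s → |f s| ≤ M * decayWeight θ L s) :
    IntegrableOn f (Ioi t) ∧
      |∫ s in Ioi t, f s| ≤ M / (θ * L) * Real.exp (L * Real.exp (-θ * t)) ∧
      |∫ s in Ioi t, f s| ≤ M / θ * decayWeight θ L t := by
  obtain ⟨hi, hv⟩ := integral_decayWeight hθ hL t
  have hi' : IntegrableOn (fun s => M * decayWeight θ L s) (Ioi t) := hi.const_mul M
  have hfi : IntegrableOn f (Ioi t) := by
    refine Integrable.mono' hi' hf.aestronglyMeasurable ?_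
    filter_upwards [ae_restrict_mem measurableSet_Ioi] with s hs using h s hs
  have hb : |∫ s in Ioi t, f s| ≤ M * ((Real.exp (L * Real.exp (-θ * t)) - 1) / (θ * L)) := by
    rw [← hv, ← integral_const_mul]
    refine (norm_integral_le_integral_norm f).trans ?_
    refine setIntegral_mono_on hfi.norm hi' measurableSet_Ioi fun s hs => h s hs
  refine ⟨hfi, hb.trans ?_, hb.trans ?_⟩
  · rw [div_mul_eq_mul_div, mul_div_assoc]
    gcongr
    linarith
  · unfold decayWeight
    set x := Real.exp (-θ * t)
    have hx : 0 < x := Real.exp_pos _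
    have h1 : 1 - L * x ≤ Real.exp (-(L * x)) := by
      have := Real.add_one_le_exp (-(L * x)); linarith
    have h2 : Real.exp (L * x) * (1 - L * x) ≤ 1 := by
      calc _ ≤ Real.exp (L * x) * Real.exp (-(L * x)) := by gcongr
        _ = 1 := by rw [← Real.exp_add]; simp
    rw [div_mul_eq_mul_div, mul_div_assoc]
    refine mul_le_mul_of_nonneg_left ?_ hM
    rw [div_le_div_iff₀ (by positivity) hθ]
    nlinarith

/-- If `q` converges exponentially fast to `κ²` at `+∞`, then `v'' = q v` has a solution
asymptotic to `e^{-κt}` at `+∞`. -/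
theorem exists_recessive_solution {q : ℝ → ℝ} (hq : Continuous q) {κ θ C : ℝ} (hκ : 0 ≤ κ)
    (hθ : 0 < θ) (hC : 0 < C) (hqC : ∀ t, |q t - κ ^ 2| ≤ C * Real.exp (-θ * t)) :
    ∃ v v', IsLineSolution q v v' ∧
      Tendsto (fun t => v t * Real.exp (κ * t)) atTop (𝓝 1) := by
  -- The map below has Lipschitz constant C/(θ²L); this L makes it 1/2.
  obtain ⟨L, hLdef⟩ : ∃ L, L = 2 * C / θ ^ 2 := ⟨_, rfl⟩
  have hL : 0 < L := by rw [hLdef]; positivity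
  let g : ℝ → ℝ := fun t => q t - κ ^ 2
  have hg : Continuous g := hq.sub continuous_const
  -- Write v = e^{-κt} h and h' = wP. The equation becomes (wP)' = 2κ wP + g h, solved by wP =
  -- -e^{2κt} ∫_t^∞ e^{-2κs} g h ds with h = 1 - ∫_t^∞ wP. The unknown is the bounded function P.
  -- The factor exp(L e^{-θt}) in the weight absorbs the growth of the bound on g as t → -∞, so one
  -- contraction works on the whole line.
  let w := decayWeight θ L
  have hwc : Continuous w := continuous_decayWeight θ L
  have hwp : ∀ t, 0 < w t := decayWeight_pos θ L
  let X := BoundedContinuousFunction ℝ ℝ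
  -- the tail of `w P`
  let J : X → ℝ → ℝ := fun P t => ∫ s in Ioi t, w s * P s
  have hJint : ∀ (P : X) t, IntegrableOn (fun s => w s * P s) (Ioi t) ∧
      |J P t| ≤ ‖P‖ / (θ * L) * Real.exp (L * Real.exp (-θ * t)) ∧
      |J P t| ≤ ‖P‖ / θ * w t := by
    intro P t
    refine integral_Ioi_bound hθ hL (hwc.mul P.continuous) (norm_nonneg P) fun s _ => ?_
    change |w s * P s| ≤ _
    rw [abs_mul, abs_of_pos (hwp s), mul_comm]
    exact mul_le_mul_of_nonneg_right (P.norm_coe_le_norm s) (hwp s).le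
  have hJd : ∀ (P : X) t, HasDerivAt (J P) (-(w t * P t)) t := fun P t =>
    hasDerivAt_integral_Ioi (hwc.mul P.continuous) (fun a => (hJint P a).1) t
  have hJc : ∀ P : X, Continuous (J P) := fun P =>
    continuous_iff_continuousAt.2 fun t => (hJd P t).continuousAt
  have hJsub : ∀ (P Q : X) t, J P t - J Q t = J (P - Q) t := by
    intro P Q t
    simp only [J]
    rw [← integral_sub (hJint P t).1 (hJint Q t).1]
    congr 1; ext s
    change _ = w s * (P s - Q s)
    ring
  -- tails of `e^{-2κs} g z` for `z` bounded by a multiple of `exp (L e^{-θs})`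
  have key : ∀ (z : ℝ → ℝ) (M : ℝ), Continuous z → 0 ≤ M →
      (∀ s, |z s| ≤ M * Real.exp (L * Real.exp (-θ * s))) → ∀ t,
      IntegrableOn (fun s => Real.exp (-2 * κ * s) * (g s * z s)) (Ioi t) ∧
      |∫ s in Ioi t, Real.exp (-2 * κ * s) * (g s * z s)| ≤
        Real.exp (-2 * κ * t) * (C * M) / θ * w t := by
    intro z M hz hM hzM t
    have := integral_Ioi_bound (f := fun s => Real.exp (-2 * κ * s) * (g s * z s)) hθ hL
      (M := Real.exp (-2 * κ * t) * (C * M)) (t := t) (by fun_prop) (by positivity) ?_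
    · exact ⟨this.1, this.2.2⟩
    · intro s hs
      rw [abs_mul, abs_mul, Real.abs_exp, mul_assoc (Real.exp _) (C * M)]
      refine mul_le_mul (Real.exp_le_exp.2 (by nlinarith)) ?_ (by positivity) (by positivity)
      · calc |g s| * |z s| ≤ (C * Real.exp (-θ * s)) *
              (M * Real.exp (L * Real.exp (-θ * s))) :=
            mul_le_mul (hqC s) (hzM s) (abs_nonneg _) (by positivity)
          _ = C * M * decayWeight θ L s := by unfold decayWeight; ring
  let h : X → ℝ → ℝ := fun P t => 1 - J P t
  have hhc : ∀ P, Continuous (h P) := fun P => continuous_const.sub (hJc P)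
  have hhb : ∀ (P : X) s, |h P s| ≤ (1 + ‖P‖ / (θ * L)) * Real.exp (L * Real.exp (-θ * s)) := by
    intro P s
    have h1 : (1 : ℝ) ≤ Real.exp (L * Real.exp (-θ * s)) := Real.one_le_exp (by positivity)
    have h2 := (hJint P s).2.1
    calc |h P s| ≤ |1| + |J P s| := abs_sub _ _
      _ ≤ _ := by rw [abs_one]; linarith
  let T : X → ℝ → ℝ := fun P t => ∫ s in Ioi t, Real.exp (-2 * κ * s) * (g s * h P s)
  have hT : ∀ (P : X) t, _ := fun P => key (h P) _ (hhc P) (by positivity) (hhb P)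
  have hTd : ∀ (P : X) t, HasDerivAt (T P) (-(Real.exp (-2 * κ * t) * (g t * h P t))) t :=
    fun P t => hasDerivAt_integral_Ioi (by have := hhc P; fun_prop) (fun a => (hT P a).1) t
  have hTc : ∀ P : X, Continuous (T P) := fun P =>
    continuous_iff_continuousAt.2 fun t => (hTd P t).continuousAt
  let S : X → ℝ → ℝ := fun P t => -(Real.exp (2 * κ * t) / w t * T P t)
  have hexp : ∀ t, Real.exp (2 * κ * t) * Real.exp (-2 * κ * t) = 1 := by
    intro t; rw [← Real.exp_add]; simp
  have hSbd : ∀ t I B, |I| ≤ Real.exp (-2 * κ * t) * (C * B) / θ * w t →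
      |Real.exp (2 * κ * t) / w t * I| ≤ C * B / θ := by
    intro t I B hI
    rw [abs_mul, abs_of_pos (div_pos (Real.exp_pos _) (hwp t))]
    calc _ ≤ Real.exp (2 * κ * t) / w t * (Real.exp (-2 * κ * t) * (C * B) / θ * w t) := by
            have := div_pos (Real.exp_pos (2 * κ * t)) (hwp t); gcongr
      _ = (Real.exp (2 * κ * t) * Real.exp (-2 * κ * t)) * (C * B / θ) := by
            field_simp [(hwp t).ne']
      _ = _ := by rw [hexp, one_mul]
  have hSc : ∀ P, Continuous (S P) := fun P => by
    have := hTc P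
    exact ((Continuous.div (by fun_prop) hwc fun t => (hwp t).ne').mul this).neg
  let F : X → X := fun P => BoundedContinuousFunction.ofNormedAddCommGroup (S P) (hSc P)
    (C * (1 + ‖P‖ / (θ * L)) / θ) fun t => by
      rw [Real.norm_eq_abs, abs_neg]
      exact hSbd t _ _ (hT P t).2
  have hcontr : ContractingWith (1 / 2) F := by
    refine ⟨by norm_num, LipschitzWith.of_dist_le_mul fun P Q => ?_⟩
    rw [dist_eq_norm, BoundedContinuousFunction.norm_le (by positivity)]
    intro t
    have e : (F P - F Q) t = Real.exp (2 * κ * t) / w t *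
        ∫ s in Ioi t, Real.exp (-2 * κ * s) * (g s * J (P - Q) s) := by
      change S P t - S Q t = _
      have : T Q t - T P t = ∫ s in Ioi t, Real.exp (-2 * κ * s) * (g s * J (P - Q) s) := by
        simp only [T]
        rw [← integral_sub (hT Q t).1 (hT P t).1]
        congr 1; ext s
        rw [← hJsub]; simp only [h]; ring
      rw [← this]; simp only [S]; ring
    rw [e, Real.norm_eq_abs]
    refine (hSbd t _ _ (key (J (P - Q)) (‖P - Q‖ / (θ * L)) (hJc _) (by positivity)
      (fun s => (hJint _ s).2.1) t).2).trans (le_of_eq ?_)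
    rw [dist_eq_norm, hLdef]
    push_cast
    field_simp
  obtain ⟨P, hP⟩ : ∃ P, F P = P := ⟨_, hcontr.fixedPoint_isFixedPt⟩
  have hPS : ∀ t, w t * P t = -(Real.exp (2 * κ * t) * T P t) := by
    intro t
    have : P t = S P t := by conv_lhs => rw [← hP]
                             rfl
    rw [this]; simp only [S]
    field_simp [(hwp t).ne']
  have hhd : ∀ t, HasDerivAt (h P) (w t * P t) t := fun t => by
    simpa using (hJd P t).const_sub 1
  have hpd : ∀ t, HasDerivAt (fun t => w t * P t) (2 * κ * (w t * P t) + g t * h P t) t := by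
    intro t
    rw [funext hPS]
    have h1 : HasDerivAt (fun t : ℝ => 2 * κ * t) (2 * κ) t := by
      simpa using (hasDerivAt_id t).const_mul (2 * κ)
    refine (h1.exp.mul (hTd P t)).neg.congr_deriv ?_
    rw [hPS]
    linear_combination (g t * h P t) * hexp t
  have hed : ∀ t, HasDerivAt (fun t : ℝ => Real.exp (-κ * t)) (-κ * Real.exp (-κ * t)) t := by
    intro t
    have h1 : HasDerivAt (fun t : ℝ => -κ * t) (-κ) t := by
      simpa using (hasDerivAt_id t).const_mul (-κ)
    exact h1.exp.congr_deriv (by ring)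
  refine ⟨fun t => Real.exp (-κ * t) * h P t,
    fun t => Real.exp (-κ * t) * (w t * P t - κ * h P t), ⟨fun t => ?_, fun t => ?_⟩, ?_⟩
  · exact ((hed t).mul (hhd t)).congr_deriv (by ring)
  · refine ((hed t).mul ((hpd t).sub ((hhd t).const_mul κ))).congr_deriv ?_
    simp only [g, Pi.sub_apply]; ring
  · have : (fun t => Real.exp (-κ * t) * h P t * Real.exp (κ * t)) = fun t => 1 - J P t := by
      ext t
      have : Real.exp (-κ * t) * Real.exp (κ * t) = 1 := by rw [← Real.exp_add]; simp
      simp only [h]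
      linear_combination (1 - J P t) * this
    rw [this]
    have hJ0 : Tendsto (J P) atTop (𝓝 0) := by
      refine squeeze_zero_norm (fun t => (hJint P t).2.2) ?_
      simpa using (tendsto_decayWeight hθ L).const_mul (‖P‖ / θ)
    simpa using hJ0.const_sub 1

/-! ### Wronskian and uniqueness on the line -/

namespace IsLineSolution

variable {q v v' u u' : ℝ → ℝ}

theorem continuous (h : IsLineSolution q v v') : Continuous v :=
  continuous_iff_continuousAt.2 fun t => (h.1 t).continuousAt

theorem continuous_deriv (h : IsLineSolution q v v') : Continuous v' :=
  continuous_iff_continuousAt.2 fun t => (h.2 t).continuousAt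

theorem sub_const_mul (h : IsLineSolution q v v') (hu : IsLineSolution q u u') (c : ℝ) :
    IsLineSolution q (fun t => v t - c * u t) (fun t => v' t - c * u' t) :=
  ⟨fun t => (h.1 t).sub ((hu.1 t).const_mul c), fun t =>
    ((h.2 t).sub ((hu.2 t).const_mul c)).congr_deriv (by ring)⟩

theorem comp_neg (h : IsLineSolution q v v') :
    IsLineSolution (fun t => q (-t)) (fun t => v (-t)) (fun t => -v' (-t)) := by
  refine ⟨fun t => ?_, fun t => ?_⟩
  · exact ((h.1 (-t)).comp t (hasDerivAt_neg t)).congr_deriv (by ring)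
  · exact ((h.2 (-t)).comp t (hasDerivAt_neg t)).neg.congr_deriv (by ring)

/-- The Wronskian of two solutions is constant. -/
theorem wronskian_eq (h : IsLineSolution q v v') (hu : IsLineSolution q u u') (s t : ℝ) :
    v s * u' s - v' s * u s = v t * u' t - v' t * u t := by
  have hd : ∀ t, HasDerivAt (fun t => v t * u' t - v' t * u t) 0 t := fun t =>
    (((h.1 t).mul (hu.2 t)).sub ((h.2 t).mul (hu.1 t))).congr_deriv (by ring)
  exact is_const_of_deriv_eq_zero (fun t => (hd t).differentiableAt) (fun t => (hd t).deriv) s t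

/-- The first-order system (v, v')' = (v', qv) is globally Lipschitz with constant max(1, K), so it
has unique solutions. -/
theorem eq_zero_of_initial {K : ℝ} (hK : ∀ t, |q t| ≤ K) (h : IsLineSolution q v v') {t₀ : ℝ}
    (h0 : v t₀ = 0) (h1 : v' t₀ = 0) : ∀ t, v t = 0 := by
  have key := ODE_solution_unique_univ (v := fun t (p : ℝ × ℝ) => (p.2, q t * p.1))
    (s := fun _ => univ) (K := Real.toNNReal (max 1 K)) (f := fun t => (v t, v' t))
    (g := fun _ => (0, 0)) (t₀ := t₀) ?_ (fun t => ⟨(h.1 t).prodMk (h.2 t), trivial⟩)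
    (fun t => ⟨(hasDerivAt_const t ((0, 0) : ℝ × ℝ)).congr_deriv (by simp [Prod.ext_iff]), trivial⟩) (by simp [h0, h1])
  · intro t; exact congrArg Prod.fst (congrFun key t)
  · intro t
    refine (LipschitzWith.of_dist_le_mul fun x y => ?_).lipschitzOnWith
    rw [Real.coe_toNNReal _ (by positivity), Prod.dist_eq, Prod.dist_eq]
    refine max_le ?_ ?_
    · calc dist x.2 y.2 ≤ 1 * max (dist x.1 y.1) (dist x.2 y.2) := by
            rw [one_mul]; exact le_max_right _ _
        _ ≤ _ := by gcongr; exact le_max_left _ _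
    · have : dist (q t * x.1) (q t * y.1) = |q t| * dist x.1 y.1 := by
        rw [Real.dist_eq, Real.dist_eq, ← mul_sub, abs_mul]
      rw [this]
      gcongr
      · exact (hK t).trans (le_max_right _ _)
      · exact le_max_left _ _

/-- Subtracting from u the multiple of v that matches its value at t₀ leaves, by the vanishing
Wronskian, zero Cauchy data. -/
theorem eq_const_mul_of_wronskian_eq_zero {K : ℝ} (hK : ∀ t, |q t| ≤ K)
    (h : IsLineSolution q v v') (hu : IsLineSolution q u u') {t₀ : ℝ} (hv : v t₀ ≠ 0)
    (hW : v t₀ * u' t₀ - v' t₀ * u t₀ = 0) : ∀ t, u t = u t₀ / v t₀ * v t := by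
  have := eq_zero_of_initial hK (hu.sub_const_mul h (u t₀ / v t₀)) (t₀ := t₀)
    (by field_simp; ring) (by field_simp; linarith)
  intro t
  have := this t
  linarith

end IsLineSolution

/-! ### Asymptotics of dominant solutions -/

/-- A form of l'Hôpital's rule at infinity. -/
theorem tendsto_div_of_tendsto_deriv_div {f f' G G' : ℝ → ℝ} {T l : ℝ}
    (hf : ∀ t, T ≤ t → HasDerivAt f (f' t) t) (hG : ∀ t, T ≤ t → HasDerivAt G (G' t) t)
    (hG' : ∀ t, T ≤ t → 0 < G' t) (hGinf : Tendsto G atTop atTop)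
    (h : Tendsto (fun t => f' t / G' t) atTop (𝓝 l)) :
    Tendsto (fun t => f t / G t) atTop (𝓝 l) := by
  rw [Metric.tendsto_atTop]
  intro ε hε
  obtain ⟨T₁, hT₁⟩ := Metric.tendsto_atTop.1 h (ε / 2) (by positivity)
  let S := max T T₁
  have hTS : T ≤ S := le_max_left _ _
  have hbd : ∀ t, S ≤ t → |f' t - l * G' t| ≤ ε / 2 * G' t := by
    intro t ht
    have h1 := hT₁ t ((le_max_right _ _).trans ht)
    have h2 := hG' t (hTS.trans ht)
    rw [Real.dist_eq] at h1
    have : f' t - l * G' t = (f' t / G' t - l) * G' t := by field_simp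
    rw [this, abs_mul, abs_of_pos h2]
    gcongr
  -- The two signs c = ±1 together bound |f - lG| by (ε/2) G plus a constant beyond S; the constant
  -- is absorbed once G is large, because G → ∞.
  have mono : ∀ c : ℝ, |c| = 1 → ∀ t, S ≤ t →
      c * (f t - l * G t) - ε / 2 * G t ≤ c * (f S - l * G S) - ε / 2 * G S := by
    intro c hc t ht
    have hd : ∀ s, S ≤ s → HasDerivAt (fun s => c * (f s - l * G s) - ε / 2 * G s)
        (c * (f' s - l * G' s) - ε / 2 * G' s) s := fun s hs =>
      ((((hf s (hTS.trans hs)).sub ((hG s (hTS.trans hs)).const_mul l)).const_mul c).sub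
        ((hG s (hTS.trans hs)).const_mul (ε / 2)))
    have anti : AntitoneOn (fun s => c * (f s - l * G s) - ε / 2 * G s) (Ici S) := by
      refine antitoneOn_of_deriv_nonpos (convex_Ici S)
        (fun s hs => (hd s hs).continuousAt.continuousWithinAt)
        (fun s hs => (hd s (interior_subset hs)).differentiableAt.differentiableWithinAt)
        fun s hs => ?_
      rw [(hd s (interior_subset hs)).deriv]
      have h1 := hbd s (interior_subset hs)
      have h2 : c * (f' s - l * G' s) ≤ |f' s - l * G' s| := by
        calc _ ≤ |c * (f' s - l * G' s)| := le_abs_self _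
          _ = _ := by rw [abs_mul, hc, one_mul]
      linarith
    exact anti self_mem_Ici ht ht
  let B := |f S - l * G S| + ε / 2 * |G S|
  have hev := (hGinf.eventually_gt_atTop (2 * (B + 1) / ε)).and (eventually_ge_atTop S)
  obtain ⟨T₂, hT₂⟩ := eventually_atTop.1 hev
  refine ⟨T₂, fun t ht => ?_⟩
  obtain ⟨h1, h2⟩ := hT₂ t ht
  have hB : 0 ≤ B := by positivity
  have hGt : 0 < G t := lt_trans (by positivity) h1
  have h3 := mono 1 (by simp) t h2
  have h4 := mono (-1) (by simp) t h2
  have h5 : 2 * (B + 1) < G t * ε := by rwa [div_lt_iff₀ hε] at h1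
  have h6 := le_abs_self (f S - l * G S)
  have h7 := neg_le_abs (f S - l * G S)
  have h8 : -(ε / 2 * G S) ≤ ε / 2 * |G S| := by nlinarith [neg_abs_le (G S)]
  rw [Real.dist_eq, show f t / G t - l = (f t - l * G t) / G t by field_simp, abs_div,
    abs_of_pos hGt, div_lt_iff₀ hGt, abs_lt]
  constructor <;> simp only [B] at * <;> nlinarith

namespace IsLineSolution

variable {q v v' u u' : ℝ → ℝ} {κ : ℝ}

/-- A solution is asymptotic to its Wronskian with the recessive solution times the dominant
profile `G e^{-κt}`, `G' = e^{2κt}`. -/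
theorem tendsto_div_dominant (hv : IsLineSolution q v v')
    (hv1 : Tendsto (fun t => v t * Real.exp (κ * t)) atTop (𝓝 1)) (hu : IsLineSolution q u u')
    {G : ℝ → ℝ} (hG : ∀ t, HasDerivAt G (Real.exp (2 * κ * t)) t)
    (hGinf : Tendsto G atTop atTop) :
    Tendsto (fun t => u t * Real.exp (κ * t) / G t) atTop (𝓝 (v 0 * u' 0 - v' 0 * u 0)) := by
  obtain ⟨T, hT⟩ := eventually_atTop.1 (hv1.eventually_const_lt (show (0 : ℝ) < 1 by simp))
  have hpos : ∀ t, T ≤ t → 0 < v t := fun t ht =>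
    pos_of_mul_pos_left (hT t ht) (Real.exp_pos _).le
  set W := v 0 * u' 0 - v' 0 * u 0 with hW
  -- Reduction of order: (u/v)' = W/v², and v⁻² is asymptotic to e^{2κt} = G'.
  have hd : ∀ t, T ≤ t → HasDerivAt (fun t => u t / v t) (W / v t ^ 2) t := by
    intro t ht
    refine ((hu.1 t).div (hv.1 t) (hpos t ht).ne').congr_deriv ?_
    rw [hW, hv.wronskian_eq hu 0 t]; ring
  have hlim : Tendsto (fun t => W / v t ^ 2 / Real.exp (2 * κ * t)) atTop (𝓝 W) := by
    have h1 : Tendsto (fun t => W / (v t * Real.exp (κ * t)) ^ 2) atTop (𝓝 (W / 1 ^ 2)) :=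
      tendsto_const_nhds.div (hv1.pow 2) (by simp)
    rw [one_pow, div_one] at h1
    refine h1.congr fun t => ?_
    rw [div_div, mul_pow, ← Real.exp_nat_mul]
    congr 3; push_cast; ring
  have key := tendsto_div_of_tendsto_deriv_div hd (fun t _ => hG t) (fun t _ => Real.exp_pos _)
    hGinf hlim
  have := key.mul hv1
  rw [mul_one] at this
  refine this.congr' ?_
  filter_upwards [eventually_ge_atTop T] with t ht
  have := (hpos t ht).ne'
  field_simp

theorem tendsto_mul_exp_neg (hκ : 0 < κ) (hv : IsLineSolution q v v')
    (hv1 : Tendsto (fun t => v t * Real.exp (κ * t)) atTop (𝓝 1)) (hu : IsLineSolution q u u') :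
    Tendsto (fun t => u t * Real.exp (-κ * t)) atTop
      (𝓝 ((v 0 * u' 0 - v' 0 * u 0) / (2 * κ))) := by
  have hG : ∀ t, HasDerivAt (fun t => Real.exp (2 * κ * t) / (2 * κ)) (Real.exp (2 * κ * t)) t := by
    intro t
    have h1 : HasDerivAt (fun t : ℝ => 2 * κ * t) (2 * κ) t := by
      simpa using (hasDerivAt_id t).const_mul (2 * κ)
    exact (h1.exp.div_const _).congr_deriv (by field_simp)
  have hGi : Tendsto (fun t => Real.exp (2 * κ * t) / (2 * κ)) atTop atTop :=
    (Real.tendsto_exp_atTop.comp (tendsto_id.const_mul_atTop (by positivity))).atTop_div_const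
      (by positivity)
  refine ((hv.tendsto_div_dominant hv1 hu hG hGi).div_const (2 * κ)).congr fun t => ?_
  have : Real.exp (2 * κ * t) = Real.exp (κ * t) * Real.exp (κ * t) := by
    rw [← Real.exp_add]; ring_nf
  rw [this, neg_mul, Real.exp_neg]
  field_simp

theorem tendsto_div_id (hv : IsLineSolution q v v') (hv1 : Tendsto v atTop (𝓝 1))
    (hu : IsLineSolution q u u') :
    Tendsto (fun t => u t / t) atTop (𝓝 (v 0 * u' 0 - v' 0 * u 0)) := by
  have := hv.tendsto_div_dominant (κ := 0) (by simpa using hv1) hu (G := id)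
    (fun t => by simpa using hasDerivAt_id t) tendsto_id
  simpa using this

end IsLineSolution

/-! ### The quadratic form on the line and its test functions -/

/-- The form `∫ φ'² + q φ²` is nonnegative on compactly supported `C¹` functions of the line. -/
def IsLineNonneg (q : ℝ → ℝ) : Prop :=
  ∀ φ φ' : ℝ → ℝ, (∀ t, HasDerivAt φ (φ' t) t) → Continuous φ' → HasCompactSupport φ →
    0 ≤ ∫ t, (φ' t ^ 2 + q t * φ t ^ 2)

theorem continuous_of_hasDerivAt {f f' : ℝ → ℝ} (h : ∀ t, HasDerivAt f (f' t) t) :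
    Continuous f :=
  continuous_iff_continuousAt.2 fun t => (h t).continuousAt

theorem HasCompactSupport.of_hasDerivAt {f f' : ℝ → ℝ} (hf : HasCompactSupport f)
    (h : ∀ t, HasDerivAt f (f' t) t) : HasCompactSupport f' := by
  have : f' = deriv f := funext fun t => (h t).deriv.symm
  rw [this]; exact hf.deriv

theorem integral_eq_zero_of_hasCompactSupport {f f' : ℝ → ℝ} (h : ∀ t, HasDerivAt f (f' t) t)
    (hc : Continuous f') (hf : HasCompactSupport f) : ∫ t, f' t = 0 :=
  integral_eq_zero_of_hasDerivAt_of_integrable h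
    (hc.integrable_of_hasCompactSupport (hf.of_hasDerivAt h))
    ((continuous_of_hasDerivAt h).integrable_of_hasCompactSupport hf)

theorem exists_smoothTransition_deriv_bound :
    ∃ (S' : ℝ → ℝ) (K : ℝ), 0 < K ∧ Continuous S' ∧
      (∀ x, HasDerivAt Real.smoothTransition (S' x) x) ∧ (∀ x, 0 ≤ S' x) ∧ (∀ x, S' x ≤ K) ∧
      ∀ x, x ∉ Icc (0 : ℝ) 1 → S' x = 0 := by
  have hc : Continuous (deriv Real.smoothTransition) :=
    (Real.smoothTransition.contDiff (n := 1)).continuous_deriv le_rfl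
  obtain ⟨K, hK⟩ := (isCompact_Icc (a := (0 : ℝ)) (b := 1)).exists_bound_of_continuousOn
    hc.continuousOn
  have hz : ∀ x, x ∉ Icc (0 : ℝ) 1 → deriv Real.smoothTransition x = 0 := by
    intro x hx
    rcases lt_or_ge x 0 with h | h
    · have : Real.smoothTransition =ᶠ[𝓝 x] fun _ => 0 := by
        filter_upwards [Iio_mem_nhds h] with y hy
        exact Real.smoothTransition.zero_of_nonpos (le_of_lt hy)
      rw [this.deriv_eq]; simp
    · have h' : 1 < x := by
        by_contra h'; exact hx ⟨h, not_lt.1 h'⟩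
      have : Real.smoothTransition =ᶠ[𝓝 x] fun _ => 1 := by
        filter_upwards [Ioi_mem_nhds h'] with y hy
        exact Real.smoothTransition.one_of_one_le (le_of_lt hy)
      rw [this.deriv_eq]; simp
  refine ⟨_, max K 1, by positivity, hc, fun x =>
    ((Real.smoothTransition.contDiff (n := 1)).differentiable one_ne_zero x).hasDerivAt,
    fun x => Real.smoothTransition.monotone.deriv_nonneg, fun x => ?_, hz⟩
  by_cases hx : x ∈ Icc (0 : ℝ) 1
  · exact ((le_abs_self _).trans (hK x hx)).trans (le_max_left _ _)
  · rw [hz x hx]; positivity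

/-- Cutoff functions equal to `1` on `[a + n, b - m]` and supported in `[a, b]`, with a
derivative of order `1/n` on the left ramp and `1/m` on the right ramp. -/
theorem exists_cutoff : ∃ K : ℝ, 0 < K ∧ ∀ a n b m : ℝ, 0 < n → 0 < m → a + n ≤ b - m →
    ∃ η η' : ℝ → ℝ, (∀ t, HasDerivAt η (η' t) t) ∧ Continuous η' ∧ HasCompactSupport η ∧
      (∀ t ∈ Icc (a + n) (b - m), η t = 1) ∧ (∀ t, t ∉ Ioo a b → η t = 0) ∧
      (∀ t ∈ Icc a (a + n), |η' t| ≤ K / n) ∧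
      (∀ t ∈ Icc (b - m) b, |η' t| ≤ K / m ∧ η' t ≤ 0) ∧
      (∀ t, t ∉ Icc a (a + n) → t ∉ Icc (b - m) b → η' t = 0) := by
  obtain ⟨S', K, hK, hSc, hSd, hS0, hSK, hSz⟩ := exists_smoothTransition_deriv_bound
  refine ⟨K, hK, fun a n b m hn hm hab => ?_⟩
  have hl : ∀ t, HasDerivAt (fun t : ℝ => (t - a) / n) (1 / n) t := fun t =>
    ((hasDerivAt_id t).sub_const a).div_const n
  have hr : ∀ t, HasDerivAt (fun t : ℝ => (b - t) / m) (-1 / m) t := fun t =>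
    ((hasDerivAt_id t).const_sub b).div_const m
  have hz : ∀ t, t ∉ Ioo a b →
      Real.smoothTransition ((t - a) / n) * Real.smoothTransition ((b - t) / m) = 0 := by
    intro t ht
    rcases le_or_gt t a with h | h
    · rw [Real.smoothTransition.zero_of_nonpos
        (div_nonpos_of_nonpos_of_nonneg (by linarith) hn.le), zero_mul]
    · have h' : b ≤ t := by by_contra h'; exact ht ⟨h, not_le.1 h'⟩
      rw [Real.smoothTransition.zero_of_nonpos
        (div_nonpos_of_nonpos_of_nonneg (by linarith) hm.le), mul_zero]
  have hl1 : ∀ t, a + n ≤ t → Real.smoothTransition ((t - a) / n) = 1 := fun t ht =>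
    Real.smoothTransition.one_of_one_le (by rw [le_div_iff₀ hn]; linarith)
  have hr1 : ∀ t, t ≤ b - m → Real.smoothTransition ((b - t) / m) = 1 := fun t ht =>
    Real.smoothTransition.one_of_one_le (by rw [le_div_iff₀ hm]; linarith)
  -- By continuity the derivative also vanishes at the endpoints 0 and 1, where the ramps meet the
  -- plateau.
  have hcl : ∀ x : ℝ, x ∉ Ioo (0 : ℝ) 1 → S' x = 0 := by
    intro x hx
    have hz' : closure (Icc (0 : ℝ) 1)ᶜ ⊆ {x | S' x = 0} :=
      closure_minimal hSz (isClosed_eq hSc continuous_const)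
    apply hz'
    rw [closure_compl, interior_Icc]
    exact hx
  have hlz : ∀ t, t ∉ Ioo a (a + n) → S' ((t - a) / n) = 0 := by
    intro t ht
    refine hcl _ fun h => ht ⟨?_, ?_⟩
    · have := h.1; rw [lt_div_iff₀ hn] at this; linarith
    · have := h.2; rw [div_lt_iff₀ hn] at this; linarith
  have hrz : ∀ t, t ∉ Ioo (b - m) b → S' ((b - t) / m) = 0 := by
    intro t ht
    refine hcl _ fun h => ht ⟨?_, ?_⟩
    · have := h.2; rw [div_lt_iff₀ hm] at this; linarith
    · have := h.1; rw [lt_div_iff₀ hm] at this; linarith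
  refine ⟨fun t => Real.smoothTransition ((t - a) / n) * Real.smoothTransition ((b - t) / m),
    fun t => S' ((t - a) / n) * (1 / n) * Real.smoothTransition ((b - t) / m) +
      Real.smoothTransition ((t - a) / n) * (S' ((b - t) / m) * (-1 / m)),
    fun t => ((hSd _).comp t (hl t)).mul ((hSd _).comp t (hr t)), ?_, ?_, ?_, hz, ?_, ?_, ?_⟩
  · have := Real.smoothTransition.continuous
    fun_prop
  · refine HasCompactSupport.intro (isCompact_Icc (a := a) (b := b)) fun t ht => hz t ?_
    exact fun h => ht (Ioo_subset_Icc_self h)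
  · intro t ht
    simp only [hl1 t ht.1, hr1 t ht.2, mul_one]
  · intro t ht
    simp only [hr1 t (by linarith [ht.2]), hrz t (fun h => by linarith [h.1, ht.2])]
    rw [zero_mul, mul_zero, add_zero, mul_one, mul_one_div, abs_div, abs_of_nonneg (hS0 _),
      abs_of_pos hn]
    gcongr
    exact hSK _
  · intro t ht
    simp only [hl1 t (by linarith [ht.1]), hlz t (fun h => by linarith [h.2, ht.1])]
    rw [zero_mul, zero_mul, zero_add, one_mul, mul_div_assoc', mul_neg_one, neg_div, abs_neg,
      abs_div, abs_of_nonneg (hS0 _), abs_of_pos hm]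
    refine ⟨?_, neg_nonpos.2 (div_nonneg (hS0 _) hm.le)⟩
    gcongr
    exact hSK _
  · intro t h1 h2
    simp only [hlz t fun h => h1 (Ioo_subset_Icc_self h), hrz t fun h => h2 (Ioo_subset_Icc_self h)]
    ring

namespace IsLineSolution

variable {q v v' : ℝ → ℝ}

/-- Since v solves the equation, the integrand on the left differs from those on the right by the
exact derivative of η²vv' + 2sηv'ζ. Only the regions where η varies contribute to the first two
terms, which is why cutoffs with small ∫ η'²v² are effective. -/
theorem energy_eq (hq : Continuous q) (hv : IsLineSolution q v v') {η η' ζ ζ' : ℝ → ℝ}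
    (hη : ∀ t, HasDerivAt η (η' t) t) (hη' : Continuous η') (hηc : HasCompactSupport η)
    (hζ : ∀ t, HasDerivAt ζ (ζ' t) t) (hζ' : Continuous ζ') (hζc : HasCompactSupport ζ) (s : ℝ) :
    ∫ t, ((η' t * v t + η t * v' t + s * ζ' t) ^ 2 + q t * (η t * v t + s * ζ t) ^ 2) =
      (∫ t, η' t ^ 2 * v t ^ 2) + 2 * s * (∫ t, η' t * (v t * ζ' t - v' t * ζ t)) +
        s ^ 2 * ∫ t, (ζ' t ^ 2 + q t * ζ t ^ 2) := by
  have cη := continuous_of_hasDerivAt hη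
  have cζ := continuous_of_hasDerivAt hζ
  have cv := hv.continuous
  have cv' := hv.continuous_deriv
  have hη'c := hηc.of_hasDerivAt hη
  have hζ'c := hζc.of_hasDerivAt hζ
  have i1 : Integrable fun t => η' t ^ 2 * v t ^ 2 := by
    refine Continuous.integrable_of_hasCompactSupport (by fun_prop) ?_
    exact hη'c.mono fun t ht => by
      simp only [Function.mem_support] at ht ⊢; rintro h; simp [h] at ht
  have i2 : Integrable fun t => η' t * (v t * ζ' t - v' t * ζ t) := by
    refine Continuous.integrable_of_hasCompactSupport (by fun_prop) ?_
    exact hη'c.mono fun t ht => by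
      simp only [Function.mem_support] at ht ⊢; rintro h; simp [h] at ht
  have i3 : Integrable fun t => ζ' t ^ 2 + q t * ζ t ^ 2 := by
    refine Continuous.integrable_of_hasCompactSupport (by fun_prop) ?_
    refine HasCompactSupport.add ?_ ?_
    · exact hζ'c.mono fun t ht => by
        simp only [Function.mem_support] at ht ⊢; rintro h; simp [h] at ht
    · exact hζc.mono fun t ht => by
        simp only [Function.mem_support] at ht ⊢; rintro h; simp [h] at ht
  let D : ℝ → ℝ := fun t => η t * (η t * (v t * v' t) + 2 * s * (v' t * ζ t))
  let D' : ℝ → ℝ := fun t => η' t * (η t * (v t * v' t) + 2 * s * (v' t * ζ t)) +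
    η t * (η' t * (v t * v' t) + η t * (v' t * v' t + v t * (q t * v t)) +
      2 * s * (q t * v t * ζ t + v' t * ζ' t))
  have hD : ∀ t, HasDerivAt D (D' t) t := fun t =>
    (hη t).mul (((hη t).mul ((hv.1 t).mul (hv.2 t))).add
      (((hv.2 t).mul (hζ t)).const_mul (2 * s)))
  have cD' : Continuous D' := by simp only [D']; fun_prop
  have sD : HasCompactSupport D := hηc.mul_right
  have i4 : Integrable D' := cD'.integrable_of_hasCompactSupport (sD.of_hasDerivAt hD)
  have e0 := integral_eq_zero_of_hasCompactSupport hD cD' sD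
  have j2 : Integrable fun t => 2 * s * (η' t * (v t * ζ' t - v' t * ζ t)) := i2.const_mul _
  have j3 : Integrable fun t => s ^ 2 * (ζ' t ^ 2 + q t * ζ t ^ 2) := i3.const_mul _
  have j12 : Integrable fun t =>
      η' t ^ 2 * v t ^ 2 + 2 * s * (η' t * (v t * ζ' t - v' t * ζ t)) := i1.add j2
  have j123 : Integrable fun t =>
      η' t ^ 2 * v t ^ 2 + 2 * s * (η' t * (v t * ζ' t - v' t * ζ t)) +
        s ^ 2 * (ζ' t ^ 2 + q t * ζ t ^ 2) := j12.add j3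
  rw [← integral_const_mul, ← integral_const_mul, ← integral_add i1 j2,
    ← integral_add j12 j3]
  refine Eq.trans ?_ (add_zero _)
  rw [← e0, ← integral_add j123 i4]
  congr 1; ext t
  simp only [D']
  ring

end IsLineSolution

theorem integral_le_of_le_indicator {f : ℝ → ℝ} {a b c d A B : ℝ} (hab : a ≤ b) (hcd : c ≤ d)
    (hf : ∀ t, 0 ≤ f t)
    (h : ∀ t, f t ≤ (Icc a b).indicator (fun _ => A) t + (Icc c d).indicator (fun _ => B) t) :
    ∫ t, f t ≤ A * (b - a) + B * (d - c) := by
  have i1 : Integrable ((Icc a b).indicator fun _ => A) :=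
    (integrable_indicator_iff measurableSet_Icc).2 (by simp)
  have i2 : Integrable ((Icc c d).indicator fun _ => B) :=
    (integrable_indicator_iff measurableSet_Icc).2 (by simp)
  refine (integral_mono_of_nonneg (Eventually.of_forall hf) (i1.add i2)
    (Eventually.of_forall h)).trans (le_of_eq ?_)
  rw [integral_add' i1 i2, integral_indicator measurableSet_Icc, integral_indicator
    measurableSet_Icc]
  simp [hab, hcd, mul_comm]

/-- If the slope p at the zero t₀ were nonzero, v cut off to (-∞, t₀] would have almost no energy
but a corner at t₀. Adding -σpζ, with ζ a bump around t₀, changes the energy to first order by at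
most -σp² and to second order by σ²p²E, which is negative for small σ. -/
theorem IsLineSolution.deriv_eq_zero_of_nonneg {q v v' : ℝ → ℝ} (hq : Continuous q)
    (hqn : IsLineNonneg q) (hv : IsLineSolution q v v') {t₀ M : ℝ}
    (hM : ∀ t ≤ t₀, |v t| ≤ M) (h0 : v t₀ = 0) : v' t₀ = 0 := by
  by_contra hp
  obtain ⟨p, hpdef⟩ : ∃ p, p = v' t₀ := ⟨_, rfl⟩
  rw [← hpdef] at hp
  have hp2 : 0 < p ^ 2 := by positivity
  obtain ⟨K, hK, cut⟩ := exists_cutoff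
  obtain ⟨ζ, ζ', hζ, hζ', hζc, hζ1, hζ0, hζl, hζr, hζz⟩ :=
    cut (t₀ - 2) 1 (t₀ + 2) 1 one_pos one_pos (by linarith)
  obtain ⟨B, hB⟩ := (isCompact_Icc (a := t₀ - 1) (b := t₀)).exists_bound_of_continuousOn
    hv.continuous_deriv.continuousOn
  have hvB : ∀ t ∈ Icc (t₀ - 1) t₀, |v t| ≤ B * (t₀ - t) := by
    intro t ht
    have := (convex_Icc (t₀ - 1) t₀).norm_image_sub_le_of_norm_hasDerivWithin_le
      (fun x _ => (hv.1 x).hasDerivWithinAt) hB ht (right_mem_Icc.2 (by linarith))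
    rw [h0, zero_sub, norm_neg, Real.norm_eq_abs, Real.norm_eq_abs,
      abs_of_nonneg (by linarith [ht.2] : 0 ≤ t₀ - t)] at this
    exact this
  set E := ∫ t, (ζ' t ^ 2 + q t * ζ t ^ 2) with hE
  have hcont : ∀ᶠ t in 𝓝 t₀, p ^ 2 / 2 < p * v' t := by
    have : Tendsto (fun t => p * v' t) (𝓝 t₀) (𝓝 (p * v' t₀)) :=
      (hv.continuous_deriv.tendsto t₀).const_mul p
    refine this.eventually_const_lt ?_
    rw [← hpdef]; nlinarith
  obtain ⟨δ, hδ, hball⟩ := Metric.eventually_nhds_iff.1 hcont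
  -- The cutoff η has a left ramp of length n, where v is bounded by M, and a right ramp of length
  -- 1/n ending at t₀, where |v| ≤ B/n. The slopes are K/n and Kn, so the two ramps cost at most
  -- K²M²/n and K²B²/n.
  have main : ∀ n : ℝ, 2 ≤ n → 1 / δ < n → ∀ σ : ℝ, 0 ≤ σ →
      0 ≤ (K ^ 2 * M ^ 2 + K ^ 2 * B ^ 2) / n - σ * p ^ 2 + σ ^ 2 * p ^ 2 * E := by
    intro n hn hnδ σ hσ
    have hn0 : 0 < n := by linarith
    have hn1 : 1 / n < δ := by rwa [div_lt_iff₀ hn0, mul_comm, ← div_lt_iff₀ hδ]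
    have hn2 : 1 / n ≤ 1 / 2 := by gcongr
    have hn3 : 0 < 1 / n := by positivity
    obtain ⟨η, η', hη, hη', hηc, hη1, hη0, hηl, hηr, hηz⟩ :=
      cut (t₀ - 3 - n) n t₀ (1 / n) hn0 hn3 (by linarith)
    rw [show t₀ - 3 - n + n = t₀ - 3 by ring] at *
    have e := hv.energy_eq hq hη hη' hηc hζ hζ' hζc (-σ * p)
    have cη := continuous_of_hasDerivAt hη
    have cζ := continuous_of_hasDerivAt hζ
    have cv := hv.continuous
    have cv' := hv.continuous_deriv
    have hnn : 0 ≤ ∫ t, ((η' t * v t + η t * v' t + -σ * p * ζ' t) ^ 2 +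
        q t * (η t * v t + -σ * p * ζ t) ^ 2) :=
      hqn (fun t => η t * v t + -σ * p * ζ t) _
        (fun t => ((hη t).mul (hv.1 t)).add ((hζ t).const_mul (-σ * p))) (by fun_prop)
        (hηc.mul_right.add hζc.mul_left)
    rw [e] at hnn
    have b1 : ∫ t, η' t ^ 2 * v t ^ 2 ≤ (K ^ 2 * M ^ 2 + K ^ 2 * B ^ 2) / n := by
      have := integral_le_of_le_indicator (f := fun t => η' t ^ 2 * v t ^ 2)
        (a := t₀ - 3 - n) (b := t₀ - 3) (c := t₀ - 1 / n) (d := t₀) (A := (K / n) ^ 2 * M ^ 2)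
        (B := (K / (1 / n)) ^ 2 * (B * (1 / n)) ^ 2) (by linarith) (by linarith)
        (fun t => by positivity) ?_
      · refine this.trans (le_of_eq ?_)
        field_simp; ring
      · intro t
        by_cases h1 : t ∈ Icc (t₀ - 3 - n) (t₀ - 3)
        · have h2 : t ∉ Icc (t₀ - 1 / n) t₀ := fun h => by linarith [h.1, h1.2]
          rw [indicator_of_mem h1, indicator_of_notMem h2, add_zero]
          refine mul_le_mul ?_ ?_ (sq_nonneg _) (sq_nonneg _)
          · exact sq_le_sq' (by linarith [(abs_le.1 (hηl t h1)).1]) (abs_le.1 (hηl t h1)).2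
          · have := hM t (by linarith [h1.2])
            exact sq_le_sq' (by linarith [(abs_le.1 this).1]) (abs_le.1 this).2
        · by_cases h2 : t ∈ Icc (t₀ - 1 / n) t₀
          · rw [indicator_of_notMem h1, indicator_of_mem h2, zero_add]
            have h3 := (hηr t h2).1
            refine mul_le_mul ?_ ?_ (sq_nonneg _) (sq_nonneg _)
            · exact sq_le_sq' (by linarith [(abs_le.1 h3).1]) (abs_le.1 h3).2
            · have h4 := hvB t ⟨by linarith [h2.1], h2.2⟩
              have hB0 : 0 ≤ B := (norm_nonneg _).trans (hB t₀ ⟨by linarith, le_rfl⟩)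
              have : |v t| ≤ B * (1 / n) :=
                h4.trans (mul_le_mul_of_nonneg_left (by linarith [h2.1]) hB0)
              exact sq_le_sq' (by linarith [(abs_le.1 this).1]) (abs_le.1 this).2
          · rw [indicator_of_notMem h1, indicator_of_notMem h2, hηz t h1 h2]; simp
    -- On the right ramp ζ = 1, pv' > p²/2 and -η' has integral 1; on the left ramp ζ vanishes, so
    -- that ramp contributes nothing.
    have b2 : p ^ 2 / 2 ≤ p * ∫ t, η' t * (v t * ζ' t - v' t * ζ t) := by
      have hint : ∫ t in (t₀ - 1 / n)..t₀, η' t = -1 := by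
        rw [intervalIntegral.integral_eq_sub_of_hasDerivAt (fun t _ => hη t)
          (hη'.intervalIntegrable _ _), hη0 t₀ (fun h => lt_irrefl _ h.2),
          hη1 _ ⟨by linarith, le_rfl⟩]
        norm_num
      rw [intervalIntegral.integral_of_le (by linarith), ← integral_Icc_eq_integral_Ioc] at hint
      have : p ^ 2 / 2 = ∫ t, (Icc (t₀ - 1 / n) t₀).indicator (fun t => -(p ^ 2 / 2) * η' t) t := by
        rw [integral_indicator measurableSet_Icc, integral_const_mul, hint]; ring
      rw [this, ← integral_const_mul]
      have hη'c := hηc.of_hasDerivAt hη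
      refine integral_mono ?_ ?_ ?_
      · exact (integrable_indicator_iff measurableSet_Icc).2
          (Continuous.integrableOn_Icc (by fun_prop))
      · refine Continuous.integrable_of_hasCompactSupport (by fun_prop) ?_
        exact hη'c.mono fun t ht => by
          simp only [Function.mem_support] at ht ⊢; rintro h; simp [h] at ht
      · intro t
        dsimp only
        by_cases h2 : t ∈ Icc (t₀ - 1 / n) t₀
        · rw [indicator_of_mem h2]
          have hz1 : ζ t = 1 := hζ1 t ⟨by linarith [h2.1], by linarith [h2.2]⟩
          have hz2 : ζ' t = 0 := hζz t (fun h => by linarith [h.2, h2.1])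
            (fun h => by linarith [h.1, h2.2])
          have h3 := (hηr t h2).2
          have h4 := hball (y := t) (by
            rw [Real.dist_eq, abs_lt]; constructor <;> linarith [h2.1, h2.2])
          rw [hz1, hz2]
          nlinarith
        · rw [indicator_of_notMem h2]
          by_cases h1 : t ∈ Icc (t₀ - 3 - n) (t₀ - 3)
          · rw [hζ0 t (fun h => by linarith [h.1, h1.2]),
              hζz t (fun h => by linarith [h.1, h1.2]) (fun h => by linarith [h.1, h1.2])]
            simp
          · rw [hηz t h1 h2]; simp
    nlinarith
  have lim : ∀ σ : ℝ, 0 ≤ σ → 0 ≤ -σ * p ^ 2 + σ ^ 2 * p ^ 2 * E := by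
    intro σ hσ
    have ht : Tendsto (fun n : ℝ => (K ^ 2 * M ^ 2 + K ^ 2 * B ^ 2) / n - σ * p ^ 2 +
        σ ^ 2 * p ^ 2 * E) atTop (𝓝 (0 - σ * p ^ 2 + σ ^ 2 * p ^ 2 * E)) :=
      ((tendsto_const_nhds.div_atTop tendsto_id).sub_const _).add_const _
    have := ge_of_tendsto ht (by
      filter_upwards [eventually_ge_atTop 2, eventually_gt_atTop (1 / δ)] with n h1 h2
      exact main n h1 h2 σ hσ)
    linarith
  have hE1 : 0 < |E| + 1 := by positivity
  -- This σ satisfies σE ≤ 1/2, so the bound is at most -σp²/2 < 0.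
  have h1 := lim (1 / (2 * (|E| + 1))) (by positivity)
  have h2 : 1 / (2 * (|E| + 1)) * E ≤ 1 / 2 := by
    rw [div_mul_eq_mul_div, div_le_div_iff₀ (by positivity) two_pos]
    linarith [le_abs_self E]
  have h3 : 0 < 1 / (2 * (|E| + 1)) := by positivity
  set σ := 1 / (2 * (|E| + 1))
  nlinarith [mul_pos h3 hp2, mul_le_mul_of_nonneg_left h2 (mul_pos h3 hp2).le]

/-- A bounded solution that never vanishes excludes a spectral gap. -/
theorem IsLineSolution.not_isLineNonneg_sub {q v v' k : ℝ → ℝ} (hq : Continuous q)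
    (hk : Continuous k) (hv : IsLineSolution q v v') {M : ℝ} (hM : ∀ t, |v t| ≤ M)
    (hk0 : ∀ t, 0 ≤ k t) {a b : ℝ} (hab : a < b) (hkab : ∀ t ∈ Icc a b, 0 < k t)
    (hvab : ∀ t ∈ Icc a b, v t ≠ 0) : ¬ IsLineNonneg fun t => q t - k t := by
  intro hn
  obtain ⟨K, hK, cut⟩ := exists_cutoff
  have cv := hv.continuous
  have cv' := hv.continuous_deriv
  obtain ⟨c, hc⟩ : ∃ c, c = ∫ t in Icc a b, k t * v t ^ 2 := ⟨_, rfl⟩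
  have hcpos : 0 < c := by
    rw [hc, integral_Icc_eq_integral_Ioc, ← intervalIntegral.integral_of_le hab.le]
    refine intervalIntegral.intervalIntegral_pos_of_pos_on
      ((hk.mul (cv.pow 2)).intervalIntegrable _ _) (fun t ht => ?_) hab
    have h1 := hkab t (Ioo_subset_Icc_self ht)
    have h2 := hvab t (Ioo_subset_Icc_self ht)
    positivity
  -- With ramps of length n the energy of ηv for q is ∫ η'²v² ≤ 2K²M²/n. The condition on n places
  -- [a, b] inside the plateau [-n, n], so the subtracted well removes at least c, a contradiction
  -- as n → ∞.
  have main : ∀ n : ℝ, |a| + |b| + 1 < n → c ≤ 2 * K ^ 2 * M ^ 2 / n := by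
    intro n hn'
    have hn0 : 0 < n := by linarith [abs_nonneg a, abs_nonneg b]
    obtain ⟨η, η', hη, hη', hηc, hη1, hη0, hηl, hηr, hηz⟩ :=
      cut (-2 * n) n (2 * n) n hn0 hn0 (by linarith)
    rw [show -2 * n + n = -n by ring, show 2 * n - n = n by ring] at *
    have cη := continuous_of_hasDerivAt hη
    have e := hv.energy_eq hq hη hη' hηc hη hη' hηc 0
    have hnn : 0 ≤ ∫ t, ((η' t * v t + η t * v' t) ^ 2 + (q t - k t) * (η t * v t) ^ 2) :=
      hn _ _ (fun t => (hη t).mul (hv.1 t)) (by fun_prop) hηc.mul_right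
    have hη'c := hηc.of_hasDerivAt hη
    have i1 : Integrable fun t => (η' t * v t + η t * v' t) ^ 2 + q t * (η t * v t) ^ 2 := by
      refine Continuous.integrable_of_hasCompactSupport (by fun_prop) ?_
      refine HasCompactSupport.intro (hη'c.isCompact.union hηc.isCompact) fun t ht => ?_
      rw [image_eq_zero_of_notMem_tsupport (f := η) fun h => ht (Or.inr h),
        image_eq_zero_of_notMem_tsupport (f := η') fun h => ht (Or.inl h)]
      simp
    have i2 : Integrable fun t => k t * (η t * v t) ^ 2 := by
      refine Continuous.integrable_of_hasCompactSupport (by fun_prop) ?_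
      refine HasCompactSupport.intro hηc.isCompact fun t ht => ?_
      rw [image_eq_zero_of_notMem_tsupport (f := η) ht]
      simp
    have hsplit : ∫ t, ((η' t * v t + η t * v' t) ^ 2 + (q t - k t) * (η t * v t) ^ 2) =
        (∫ t, ((η' t * v t + η t * v' t) ^ 2 + q t * (η t * v t) ^ 2)) -
          ∫ t, k t * (η t * v t) ^ 2 := by
      rw [← integral_sub i1 i2]
      congr 1; ext t; ring
    have hen : ∫ t, ((η' t * v t + η t * v' t) ^ 2 + q t * (η t * v t) ^ 2) =
        ∫ t, η' t ^ 2 * v t ^ 2 := by simpa using e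
    have b1 : ∫ t, η' t ^ 2 * v t ^ 2 ≤ 2 * K ^ 2 * M ^ 2 / n := by
      have := integral_le_of_le_indicator (f := fun t => η' t ^ 2 * v t ^ 2)
        (a := -2 * n) (b := -n) (c := n) (d := 2 * n) (A := (K / n) ^ 2 * M ^ 2)
        (B := (K / n) ^ 2 * M ^ 2) (by linarith) (by linarith) (fun t => by positivity) ?_
      · refine this.trans (le_of_eq ?_)
        field_simp; ring
      · intro t
        have hv2 : v t ^ 2 ≤ M ^ 2 :=
          sq_le_sq' (by linarith [(abs_le.1 (hM t)).1]) (abs_le.1 (hM t)).2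
        have hle : ∀ x : ℝ, |x| ≤ K / n → x ^ 2 * v t ^ 2 ≤ (K / n) ^ 2 * M ^ 2 := fun x hx =>
          mul_le_mul (sq_le_sq' (by linarith [(abs_le.1 hx).1]) (abs_le.1 hx).2) hv2
            (sq_nonneg _) (sq_nonneg _)
        by_cases h1 : t ∈ Icc (-2 * n) (-n)
        · have h2 : t ∉ Icc n (2 * n) := fun h => by linarith [h.1, h1.2]
          rw [indicator_of_mem h1, indicator_of_notMem h2, add_zero]
          exact hle _ (hηl t h1)
        · by_cases h2 : t ∈ Icc n (2 * n)
          · rw [indicator_of_notMem h1, indicator_of_mem h2, zero_add]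
            exact hle _ (hηr t h2).1
          · rw [indicator_of_notMem h1, indicator_of_notMem h2, hηz t h1 h2]; simp
    have b2 : c ≤ ∫ t, k t * (η t * v t) ^ 2 := by
      have : c = ∫ t in Icc a b, k t * (η t * v t) ^ 2 := by
        rw [hc]
        refine setIntegral_congr_fun measurableSet_Icc fun t ht => ?_
        rw [hη1 t ⟨by linarith [ht.1, neg_abs_le a, abs_nonneg b],
          by linarith [ht.2, le_abs_self b, abs_nonneg a]⟩, one_mul]
      rw [this]
      exact setIntegral_le_integral i2 (Eventually.of_forall fun t =>
        mul_nonneg (hk0 t) (sq_nonneg _))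
    linarith
  have ht : Tendsto (fun n : ℝ => 2 * K ^ 2 * M ^ 2 / n) atTop (𝓝 0) :=
    tendsto_const_nhds.div_atTop tendsto_id
  have := ge_of_tendsto ht (by
    filter_upwards [eventually_gt_atTop (|a| + |b| + 1)] with n hn using main n hn)
  linarith

/-! ### From ℝ^N to the line: smooth and radial test functions -/

open scoped Convolution

/-- Nonnegativity of the form on the line can be tested with smooth functions. -/
theorem isLineNonneg_of_smooth {q : ℝ → ℝ} (hq : Continuous q)
    (h : ∀ ψ : ℝ → ℝ, ContDiff ℝ ∞ ψ → HasCompactSupport ψ →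
      0 ≤ ∫ t, (deriv ψ t ^ 2 + q t * ψ t ^ 2)) : IsLineNonneg q := by
  intro φ φ' hφ hφ' hφc
  have cφ := continuous_of_hasDerivAt hφ
  have hd : deriv φ = φ' := funext fun t => (hφ t).deriv
  have hφ1 : ContDiff ℝ 1 φ := contDiff_one_iff_deriv.2
    ⟨fun t => (hφ t).differentiableAt, by rwa [hd]⟩
  have hφ'c := hφc.of_hasDerivAt hφ
  -- Mollifiers of radius at most 1: all mollified functions live in one compact set T and keep the
  -- sup bounds of φ and φ', which gives dominated convergence.
  let b : ℕ → ContDiffBump (0 : ℝ) := fun n =>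
    ⟨1 / (2 * ((n : ℝ) + 1)), 1 / ((n : ℝ) + 1), by positivity, by
      gcongr; linarith [(by positivity : 0 < (n : ℝ) + 1)]⟩
  have hb0 : Tendsto (fun n => (b n).rOut) atTop (𝓝 0) := tendsto_one_div_add_atTop_nhds_zero_nat
  have hb1 : ∀ n, (b n).rOut ≤ 1 := fun n => by
    change 1 / ((n : ℝ) + 1) ≤ 1
    rw [div_le_one (by positivity)]; linarith [(by positivity : 0 ≤ (n : ℝ))]
  let conv : ℕ → (ℝ → ℝ) → ℝ → ℝ := fun n g =>
    ((b n).normed volume ⋆[ContinuousLinearMap.lsmul ℝ ℝ, volume] g)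
  have hbound : ∀ n g x ε, 0 ≤ ε → Continuous g → (∀ y ∈ Metric.ball x (b n).rOut, |g y| ≤ ε) →
      |conv n g x| ≤ ε := by
    intro n g x ε hε hg hgε
    have := dist_convolution_le (μ := volume) (g := g) (z₀ := (0 : ℝ)) (x₀ := x) hε
      (b n).support_normed_eq.subset (b n).nonneg_normed (b n).integral_normed
      hg.aestronglyMeasurable (by simpa using hgε)
    simpa using this
  have hsmooth : ∀ n, ContDiff ℝ ∞ (conv n φ) := fun n =>
    (b n).hasCompactSupport_normed.contDiff_convolution_left _ (b n).contDiff_normed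
      cφ.locallyIntegrable
  have hder : ∀ n, deriv (conv n φ) = conv n φ' := by
    intro n; ext x
    rw [← hd]
    exact (hφc.hasDerivAt_convolution_right _ ((b n).continuous_normed.locallyIntegrable) hφ1 x).deriv
  have hsupp : ∀ n, HasCompactSupport (conv n φ) := fun n =>
    (b n).hasCompactSupport_normed.convolution _ hφc
  have hlim : ∀ g : ℝ → ℝ, Continuous g → ∀ x, Tendsto (fun n => conv n g x) atTop (𝓝 (g x)) :=
    fun g hg x => ContDiffBump.convolution_tendsto_right_of_continuous hb0 hg x
  obtain ⟨M, hM⟩ := hφc.exists_bound_of_continuous cφ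
  obtain ⟨M', hM'⟩ := hφ'c.exists_bound_of_continuous hφ'
  have hM0 : 0 ≤ M := (norm_nonneg _).trans (hM 0)
  have hM'0 : 0 ≤ M' := (norm_nonneg _).trans (hM' 0)
  let T := Metric.cthickening 1 (tsupport φ)
  have hT : IsCompact T := hφc.isCompact.cthickening
  have hout : ∀ n x, x ∉ T → conv n φ x = 0 ∧ conv n φ' x = 0 := by
    intro n x hx
    have hy : ∀ y ∈ Metric.ball x (b n).rOut, y ∉ tsupport φ := fun y hy hy' =>
      hx (Metric.mem_cthickening_of_dist_le _ _ _ _ hy' (by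
        rw [dist_comm]; exact (Metric.mem_ball.1 hy).le.trans (hb1 n)))
    constructor
    · exact abs_nonpos_iff.1 (hbound n φ x 0 le_rfl cφ fun y h' => by
        rw [image_eq_zero_of_notMem_tsupport (hy y h')]; simp)
    · exact abs_nonpos_iff.1 (hbound n φ' x 0 le_rfl hφ' fun y h' => by
        have : y ∉ tsupport φ' := fun h'' => hy y h' (by
          rw [← hd] at h''; exact tsupport_deriv_subset h'')
        rw [image_eq_zero_of_notMem_tsupport this]; simp)
  have htend : Tendsto (fun n => ∫ t, (deriv (conv n φ) t ^ 2 + q t * conv n φ t ^ 2)) atTop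
      (𝓝 (∫ t, (φ' t ^ 2 + q t * φ t ^ 2))) := by
    refine tendsto_integral_of_dominated_convergence
      (T.indicator fun t => M' ^ 2 + |q t| * M ^ 2) (fun n => ?_) ?_ (fun n => ?_) ?_
    · rw [hder]
      have c1 : Continuous (conv n φ) := (hsmooth n).continuous
      have c2 : Continuous (conv n φ') := by
        rw [← hder]; exact (hsmooth n).continuous_deriv (by simp)
      exact Continuous.aestronglyMeasurable (by fun_prop)
    · exact (integrable_indicator_iff hT.measurableSet).2
        (ContinuousOn.integrableOn_compact hT (by fun_prop))
    · refine Eventually.of_forall fun x => ?_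
      rw [hder]
      by_cases hx : x ∈ T
      · rw [indicator_of_mem hx, Real.norm_eq_abs]
        have h1 := hbound n φ x M hM0 cφ fun y _ => hM y
        have h2 := hbound n φ' x M' hM'0 hφ' fun y _ => hM' y
        refine (abs_add_le _ _).trans (add_le_add ?_ ?_)
        · rw [abs_pow]; gcongr
        · rw [abs_mul, abs_pow]; gcongr
      · rw [indicator_of_notMem hx, (hout n x hx).1, (hout n x hx).2]; simp
    · refine Eventually.of_forall fun x => ?_
      simp only [hder]
      exact ((hlim φ' hφ' x).pow 2).add (((hlim φ cφ x).pow 2).const_mul (q x))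
  exact ge_of_tendsto' htend fun n => h _ (hsmooth n) (hsupp n)

/-- The potential on the line obtained from `V` by the substitution
`u(r) = r^{-(N-2)/2} v(log r)`. -/
noncomputable def linePotential (N : ℕ) (V : ℝ → ℝ) (t : ℝ) : ℝ :=
  Real.exp t ^ 2 * V (Real.exp t) + (((N : ℝ) - 2) / 2) ^ 2

theorem continuous_linePotential (N : ℕ) {V : ℝ → ℝ} (hV : ContinuousOn V (Ioi 0)) :
    Continuous (linePotential N V) := by
  have : Continuous fun t => V (Real.exp t) :=
    hV.comp_continuous Real.continuous_exp fun t => Real.exp_pos t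
  exact ((Real.continuous_exp.pow 2).mul this).add continuous_const

/-- Testing a radial operator with radial functions. -/
theorem IsNonnegSchrodinger.isLineNonneg {N : ℕ} (hN : 2 ≤ N) {V : ℝ → ℝ}
    (hV : ContinuousOn V (Ioi 0)) (h : IsNonnegSchrodinger (radialPotential N V)) :
    IsLineNonneg (linePotential N V) := by
  refine isLineNonneg_of_smooth (continuous_linePotential N hV) fun ψ hψ hψc => ?_
  let E := EuclideanSpace ℝ (Fin N)
  obtain ⟨a, ha⟩ : ∃ a, a = ((N : ℝ) - 2) / 2 := ⟨_, rfl⟩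
  have hψd : ∀ t, HasDerivAt ψ (deriv ψ t) t := fun t =>
    (hψ.differentiable (by simp) t).hasDerivAt
  obtain ⟨R, hR⟩ : ∃ R, ∀ t, R < |t| → ψ t = 0 := by
    obtain ⟨R, hR⟩ := hψc.isCompact.isBounded.subset_closedBall 0
    refine ⟨R, fun t ht => image_eq_zero_of_notMem_tsupport fun h' => ?_⟩
    have := hR h'
    rw [Metric.mem_closedBall, dist_zero_right, Real.norm_eq_abs] at this
    linarith
  let f : ℝ → ℝ := fun r => Real.exp (-a * Real.log r) * ψ (Real.log r)
  let f' : ℝ → ℝ := fun r => Real.exp (-a * Real.log r) *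
    (deriv ψ (Real.log r) - a * ψ (Real.log r)) / r
  have hf : ∀ r, 0 < r → HasDerivAt f (f' r) r := by
    intro r hr
    have hl := Real.hasDerivAt_log hr.ne'
    refine ((hl.const_mul (-a)).exp.mul ((hψd _).comp r hl)).congr_deriv ?_
    simp only [f', Function.comp]; field_simp; ring
  -- The test function |x|^{-a} ψ(log|x|). Compact support of ψ makes it vanish both near the origin
  -- and near infinity.
  let φ : E → ℝ := fun x => if x = 0 then 0 else f ‖x‖
  have hφ : ∀ x, x ≠ 0 → φ =ᶠ[𝓝 x] fun x => f ‖x‖ := fun x hx => by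
    filter_upwards [isOpen_ne.mem_nhds hx] with y hy
    simp only [φ, if_neg hy]
  have hsmall : ∀ x : E, ‖x‖ < Real.exp (-|R|) → φ x = 0 := by
    intro x hx
    by_cases h0 : x = 0
    · simp [φ, h0]
    · have : Real.log ‖x‖ < -|R| := by rwa [Real.log_lt_iff_lt_exp (norm_pos_iff.2 h0)]
      simp only [φ, if_neg h0, f]
      rw [hR, mul_zero]
      rw [abs_of_neg (by linarith [abs_nonneg R])]
      linarith [le_abs_self R]
  have hφ0 : φ =ᶠ[𝓝 0] fun _ => 0 := by
    filter_upwards [Metric.ball_mem_nhds (0 : E) (Real.exp_pos (-|R|))] with x hx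
    exact hsmall x (by simpa using hx)
  have hφs : ContDiff ℝ ∞ φ := by
    rw [contDiff_iff_contDiffAt]
    intro x
    by_cases hx : x = 0
    · rw [hx]; exact contDiffAt_const.congr_of_eventuallyEq hφ0
    · refine ContDiffAt.congr_of_eventuallyEq ?_ (hφ x hx)
      have hl : ContDiffAt ℝ ∞ (fun x : E => Real.log ‖x‖) x :=
        (contDiffAt_norm ℝ hx).log (norm_ne_zero_iff.2 hx)
      exact (contDiffAt_const.mul hl).exp.mul (hψ.contDiffAt.comp x hl)
  have hφc : HasCompactSupport φ := by
    refine HasCompactSupport.intro (isCompact_closedBall (0 : E) (Real.exp |R|)) fun x hx => ?_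
    have hx' : Real.exp |R| < ‖x‖ := by simpa using hx
    have hx0 : x ≠ 0 := norm_pos_iff.1 ((Real.exp_pos _).trans hx')
    have : |R| < Real.log ‖x‖ := by rwa [Real.lt_log_iff_exp_lt (norm_pos_iff.2 hx0)]
    simp only [φ, if_neg hx0, f]
    rw [hR, mul_zero]
    exact (le_abs_self R).trans_lt (this.trans_le (le_abs_self _))
  have hφ0' : tsupport φ ⊆ {0}ᶜ := by
    intro x hx
    rw [mem_compl_singleton_iff]
    rintro rfl
    exact (notMem_tsupport_iff_eventuallyEq.2 hφ0) hx
  have hpos := h φ hφs hφc hφ0'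
  have : Nontrivial E := by
    have : Nonempty (Fin N) := ⟨⟨0, by omega⟩⟩
    infer_instance
  have hgrad : ∀ x : E, x ≠ 0 → ‖gradient φ x‖ ^ 2 = f' ‖x‖ ^ 2 := by
    intro x hx
    have h1 : ‖gradient φ x‖ = ‖fderiv ℝ φ x‖ := by
      exact LinearIsometryEquiv.norm_map _ _
    have hn : DifferentiableAt ℝ (fun x : E => ‖x‖) x :=
      (contDiffAt_norm ℝ hx (n := 1)).differentiableAt one_ne_zero
    have h2 : fderiv ℝ φ x = f' ‖x‖ • fderiv ℝ (fun x : E => ‖x‖) x := by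
      rw [(hφ x hx).fderiv_eq]
      exact ((hf _ (norm_pos_iff.2 hx)).comp_hasFDerivAt x hn.hasFDerivAt).fderiv
    rw [h1, h2, norm_smul, norm_fderiv_norm hn, mul_one, Real.norm_eq_abs, sq_abs]
  let g : ℝ → ℝ := fun r => f' r ^ 2 + V r * f r ^ 2
  have hae : ∫ x : E, (‖gradient φ x‖ ^ 2 + radialPotential N V x * φ x ^ 2) =
      ∫ x : E, g ‖x‖ := by
    refine integral_congr_ae ?_
    filter_upwards [compl_mem_ae_iff.2 (measure_singleton (0 : E))] with x hx
    have hx' : x ≠ 0 := hx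
    simp only [hgrad x hx', radialPotential, φ, if_neg hx', g]
  rw [hae, integral_fun_norm_addHaar (volume : Measure E) g, finrank_euclideanSpace_fin,
    nsmul_eq_mul, smul_eq_mul] at hpos
  have hball : 0 < (volume : Measure E).real (Metric.ball 0 1) :=
    ENNReal.toReal_pos (Metric.measure_ball_pos _ _ one_pos).ne' measure_ball_lt_top.ne
  have hNpos : (0 : ℝ) < N := by exact_mod_cast (by omega : 0 < N)
  have hI : 0 ≤ ∫ y in Ioi (0 : ℝ), y ^ (N - 1) • g y :=
    nonneg_of_mul_nonneg_right (nonneg_of_mul_nonneg_right hpos hNpos) hball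
  -- With r = e^t the measure r^{N-1} dr is e^{2t} e^{2at} dt; the factor e^{2at} cancels the square
  -- of r^{-a}, and e^{2t} cancels the r^{-2} of f'².
  have hcv : ∫ y in Ioi (0 : ℝ), y ^ (N - 1) • g y =
      ∫ t, ((deriv ψ t - a * ψ t) ^ 2 + (linePotential N V t - a ^ 2) * ψ t ^ 2) := by
    rw [← Real.range_exp, ← image_univ, integral_image_eq_integral_abs_deriv_smul
      MeasurableSet.univ (fun t _ => (Real.hasDerivAt_exp t).hasDerivWithinAt)
      Real.exp_injective.injOn, setIntegral_univ]
    congr 1; ext t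
    have h1 : Real.exp t * Real.exp t ^ (N - 1) = Real.exp t ^ 2 * Real.exp (a * t) ^ 2 := by
      rw [mul_comm, ← pow_succ, Nat.sub_add_cancel (by omega), ← Real.exp_nat_mul,
        ← Real.exp_nat_mul, ← Real.exp_nat_mul, ← Real.exp_add, ha]
      congr 1; push_cast; ring
    have h2 : Real.exp (a * t) * Real.exp (-a * t) = 1 := by rw [← Real.exp_add]; simp
    simp only [smul_eq_mul, Real.abs_exp, g, f, f', Real.log_exp, linePotential, ← ha]
    rw [← mul_assoc, h1]
    have h3 : Real.exp t ≠ 0 := (Real.exp_pos t).ne'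
    generalize Real.exp (-a * t) = e at *
    field_simp
    linear_combination ((deriv ψ t - a * ψ t) ^ 2 + Real.exp t ^ 2 * V (Real.exp t) * ψ t ^ 2) *
      (Real.exp (a * t) * e + 1) * h2
  have cψ' : Continuous (deriv ψ) := hψ.continuous_deriv (by simp)
  have cψ := hψ.continuous
  have cq := continuous_linePotential N hV
  have hψ'c : HasCompactSupport (deriv ψ) := hψc.deriv
  have i1 : Integrable fun t => (deriv ψ t - a * ψ t) ^ 2 +
      (linePotential N V t - a ^ 2) * ψ t ^ 2 := by
    refine Continuous.integrable_of_hasCompactSupport (by fun_prop) ?_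
    refine HasCompactSupport.intro (hψ'c.isCompact.union hψc.isCompact) fun t ht => ?_
    rw [image_eq_zero_of_notMem_tsupport (f := ψ) fun h => ht (Or.inr h),
      image_eq_zero_of_notMem_tsupport (f := deriv ψ) fun h => ht (Or.inl h)]
    simp
  -- The cross term -2aψψ' is an exact derivative, so it drops out and leaves ψ'² + qψ².
  have hD : ∀ t, HasDerivAt (fun t => ψ t * (a * ψ t)) (2 * a * (ψ t * deriv ψ t)) t := fun t =>
    ((hψd t).mul ((hψd t).const_mul a)).congr_deriv (by ring)
  have cD : Continuous fun t => 2 * a * (ψ t * deriv ψ t) := by fun_prop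
  have sD : HasCompactSupport fun t => ψ t * (a * ψ t) := hψc.mul_right
  have i2 : Integrable fun t => 2 * a * (ψ t * deriv ψ t) :=
    cD.integrable_of_hasCompactSupport (sD.of_hasDerivAt hD)
  have e0 := integral_eq_zero_of_hasCompactSupport hD cD sD
  rw [hcv] at hI
  refine hI.trans_eq ?_
  calc _ = (∫ t, ((deriv ψ t - a * ψ t) ^ 2 + (linePotential N V t - a ^ 2) * ψ t ^ 2)) +
        ∫ t, 2 * a * (ψ t * deriv ψ t) := by rw [e0, add_zero]
    _ = _ := by
      rw [← integral_add i1 i2]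
      congr 1; ext t; ring

/-! ### The energy form on ℝ^N -/

section energy

variable {N : ℕ} {Q Q₁ Q₂ φ : EuclideanSpace ℝ (Fin N) → ℝ}

theorem eventuallyEq_zero_of_tsupport_subset (hφ0 : tsupport φ ⊆ {0}ᶜ) : φ =ᶠ[𝓝 0] 0 :=
  notMem_tsupport_iff_eventuallyEq.1 fun h => hφ0 h rfl

theorem continuous_mul_sq (hQ : ContinuousOn Q {0}ᶜ) (hφ : Continuous φ)
    (hφ0 : tsupport φ ⊆ {0}ᶜ) : Continuous fun x => Q x * φ x ^ 2 := by
  rw [continuous_iff_continuousAt]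
  intro x
  by_cases hx : x = 0
  · rw [hx]
    refine (continuousAt_const (y := (0 : ℝ))).congr ?_
    filter_upwards [eventuallyEq_zero_of_tsupport_subset hφ0] with y hy
    simp [hy]
  · exact (hQ.continuousAt (isOpen_compl_singleton.mem_nhds hx)).mul (hφ.continuousAt.pow 2)

theorem integrable_mul_sq (hQ : ContinuousOn Q {0}ᶜ) (hφ : Continuous φ)
    (hφc : HasCompactSupport φ) (hφ0 : tsupport φ ⊆ {0}ᶜ) : Integrable fun x => Q x * φ x ^ 2 := by
  refine (continuous_mul_sq hQ hφ hφ0).integrable_of_hasCompactSupport ?_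
  refine HasCompactSupport.intro hφc.isCompact fun x hx => ?_
  rw [image_eq_zero_of_notMem_tsupport hx]; simp

theorem norm_gradient (φ : EuclideanSpace ℝ (Fin N) → ℝ) (x : EuclideanSpace ℝ (Fin N)) :
    ‖gradient φ x‖ = ‖fderiv ℝ φ x‖ :=
  LinearIsometryEquiv.norm_map _ _

theorem integrable_norm_gradient_sq (hφ : ContDiff ℝ ∞ φ) (hφc : HasCompactSupport φ) :
    Integrable fun x => ‖gradient φ x‖ ^ 2 := by
  simp only [norm_gradient]
  refine Continuous.integrable_of_hasCompactSupport
    ((hφ.continuous_fderiv (by simp)).norm.pow 2) ?_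
  refine HasCompactSupport.intro (hφc.fderiv ℝ).isCompact fun x hx => ?_
  rw [image_eq_zero_of_notMem_tsupport hx]; simp

theorem integral_energy (hQ : ContinuousOn Q {0}ᶜ) (hφ : ContDiff ℝ ∞ φ)
    (hφc : HasCompactSupport φ) (hφ0 : tsupport φ ⊆ {0}ᶜ) :
    ∫ x, (‖gradient φ x‖ ^ 2 + Q x * φ x ^ 2) =
      (∫ x, ‖gradient φ x‖ ^ 2) + ∫ x, Q x * φ x ^ 2 :=
  integral_add (integrable_norm_gradient_sq hφ hφc) (integrable_mul_sq hQ hφ.continuous hφc hφ0)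

theorem IsNonnegSchrodinger.mono (h : IsNonnegSchrodinger Q₁) (hQ₁ : ContinuousOn Q₁ {0}ᶜ)
    (hQ₂ : ContinuousOn Q₂ {0}ᶜ) (hle : ∀ x, x ≠ 0 → Q₁ x ≤ Q₂ x) : IsNonnegSchrodinger Q₂ := by
  intro φ hφ hφc hφ0
  refine (h φ hφ hφc hφ0).trans ?_
  rw [integral_energy hQ₁ hφ hφc hφ0, integral_energy hQ₂ hφ hφc hφ0]
  refine add_le_add le_rfl ?_
  refine integral_mono (integrable_mul_sq hQ₁ hφ.continuous hφc hφ0)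
    (integrable_mul_sq hQ₂ hφ.continuous hφc hφ0) fun x => ?_
  by_cases hx : x = 0
  · have : φ x = 0 := by rw [hx]; exact (eventuallyEq_zero_of_tsupport_subset hφ0).eq_of_nhds
    simp [this]
  · exact mul_le_mul_of_nonneg_right (hle x hx) (sq_nonneg _)

theorem IsNonnegSchrodinger.convex_comb (h₁ : IsNonnegSchrodinger Q₁)
    (h₂ : IsNonnegSchrodinger Q₂) (hQ₁ : ContinuousOn Q₁ {0}ᶜ) (hQ₂ : ContinuousOn Q₂ {0}ᶜ)
    {s t : ℝ} (hs : 0 ≤ s) (ht : 0 ≤ t) (hst : s + t = 1) :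
    IsNonnegSchrodinger fun x => s * Q₁ x + t * Q₂ x := by
  intro φ hφ hφc hφ0
  have e₁ := h₁ φ hφ hφc hφ0
  have e₂ := h₂ φ hφ hφc hφ0
  have i₁ := integrable_mul_sq hQ₁ hφ.continuous hφc hφ0
  have i₂ := integrable_mul_sq hQ₂ hφ.continuous hφc hφ0
  rw [integral_energy hQ₁ hφ hφc hφ0] at e₁
  rw [integral_energy hQ₂ hφ hφc hφ0] at e₂
  rw [integral_energy (Q := fun x => s * Q₁ x + t * Q₂ x)
    ((hQ₁.const_mul s).add (hQ₂.const_mul t)) hφ hφc hφ0]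
  have : ∫ x, (s * Q₁ x + t * Q₂ x) * φ x ^ 2 =
      s * (∫ x, Q₁ x * φ x ^ 2) + t * ∫ x, Q₂ x * φ x ^ 2 := by
    rw [← integral_const_mul, ← integral_const_mul,
      ← integral_add (i₁.const_mul s) (i₂.const_mul t)]
    congr 1; ext x; ring
  rw [this]
  have hs' : s = 1 - t := by linarith
  have := mul_nonneg hs e₁
  have := mul_nonneg ht e₂
  subst hs'
  nlinarith

theorem IsSubcritical.isNonneg (h : IsSubcritical Q) : IsNonnegSchrodinger Q := by
  obtain ⟨ε₀, hε₀, h⟩ := h (fun _ => 0) contDiff_const HasCompactSupport.zero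
  simpa using h (ε₀ / 2) (by positivity) (by linarith)

end energy

theorem continuousOn_comp_norm {N : ℕ} {V : ℝ → ℝ} (hV : ContinuousOn V (Ioi 0)) :
    ContinuousOn (fun x : EuclideanSpace ℝ (Fin N) => V ‖x‖) {0}ᶜ :=
  hV.comp continuous_norm.continuousOn fun _ hx => norm_pos_iff.2 hx

theorem integral_fderiv_apply_eq_zero {N : ℕ} {f : EuclideanSpace ℝ (Fin N) → ℝ}
    (hf : ContDiff ℝ 1 f) (hfc : HasCompactSupport f) (v : EuclideanSpace ℝ (Fin N)) :
    ∫ x, fderiv ℝ f x v = 0 := by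
  have i1 : Integrable fun x => fderiv ℝ f x v :=
    ((hf.continuous_fderiv one_ne_zero).clm_apply continuous_const).integrable_of_hasCompactSupport
      (hfc.fderiv_apply ℝ v)
  have := integral_mul_fderiv_eq_neg_fderiv_mul_of_integrable (μ := volume)
    (f := fun _ : EuclideanSpace ℝ (Fin N) => (1 : ℝ)) (g := f) (v := v) (by simp)
    (by simpa using i1) (by simpa using hf.continuous.integrable_of_hasCompactSupport hfc)
    (fun x _ => differentiableAt_const _) (fun x _ => hf.differentiable one_ne_zero x)
  simpa using this

/-- If `div F + |F|² ≤ Q` for the radial vector field `F(x) = M(|x|²) x`, then `-Δ + Q` is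
nonnegative. -/
theorem isNonnegSchrodinger_of_divergence_le {N : ℕ} {Q : EuclideanSpace ℝ (Fin N) → ℝ}
    (hQ : ContinuousOn Q {0}ᶜ) {M M' : ℝ → ℝ} (hM : ∀ s, 0 < s → HasDerivAt M (M' s) s)
    (hM' : ContinuousOn M' (Ioi 0))
    (h : ∀ x, x ≠ 0 → N * M (‖x‖ ^ 2) + 2 * ‖x‖ ^ 2 * M' (‖x‖ ^ 2) +
      ‖x‖ ^ 2 * M (‖x‖ ^ 2) ^ 2 ≤ Q x) : IsNonnegSchrodinger Q := by
  intro φ hφ hφc hφ0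
  let E := EuclideanSpace ℝ (Fin N)
  have hφz := eventuallyEq_zero_of_tsupport_subset hφ0
  have hM1 : ContDiffOn ℝ 1 M (Ioi 0) := by
    rw [show (1 : WithTop ℕ∞) = 0 + 1 by simp, contDiffOn_succ_iff_deriv_of_isOpen isOpen_Ioi]
    refine ⟨fun s hs => (hM s hs).differentiableAt.differentiableWithinAt, by simp, ?_⟩
    rw [contDiffOn_zero]
    exact hM'.congr fun s hs => (hM s hs).deriv
  -- The components of φ²F; the divergence of this field integrates to zero.
  let f : Fin N → E → ℝ := fun i x => φ x ^ 2 * M (‖x‖ ^ 2) * x i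
  have hfz : ∀ i, f i =ᶠ[𝓝 0] fun _ => 0 := fun i => by
    filter_upwards [hφz] with x (hx : φ x = 0)
    simp [f, hx]
  have hf : ∀ i, ContDiff ℝ 1 (f i) := by
    intro i
    rw [contDiff_iff_contDiffAt]
    intro x
    by_cases hx : x = 0
    · rw [hx]; exact contDiffAt_const.congr_of_eventuallyEq (hfz i)
    · have h1 : ContDiffAt ℝ 1 M (‖x‖ ^ 2) :=
        hM1.contDiffAt (Ioi_mem_nhds (by have := norm_pos_iff.2 hx; positivity))
      have h2 : ContDiffAt ℝ 1 (fun x : E => ‖x‖ ^ 2) x := (contDiff_norm_sq ℝ).contDiffAt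
      have h3 : ContDiffAt ℝ 1 (fun x : E => x i) x :=
        (EuclideanSpace.proj (𝕜 := ℝ) i).contDiff.contDiffAt
      have h4 : ContDiffAt ℝ 1 φ x := (hφ.of_le (by simp)).contDiffAt
      exact ((h4.pow 2).mul (h1.comp x h2)).mul h3
  have hfc : ∀ i, HasCompactSupport (f i) := fun i =>
    HasCompactSupport.intro hφc.isCompact fun x hx => by
      simp [f, image_eq_zero_of_notMem_tsupport hx]
  have hfi : ∀ i, Integrable fun x => fderiv ℝ (f i) x (EuclideanSpace.single i 1) := fun i =>
    (((hf i).continuous_fderiv one_ne_zero).clm_apply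
      continuous_const).integrable_of_hasCompactSupport ((hfc i).fderiv_apply ℝ _)
  have hdiv : ∀ x, x ≠ 0 → ∑ i, fderiv ℝ (f i) x (EuclideanSpace.single i 1) =
      2 * (φ x * M (‖x‖ ^ 2)) * inner ℝ (gradient φ x) x +
        φ x ^ 2 * (N * M (‖x‖ ^ 2) + 2 * ‖x‖ ^ 2 * M' (‖x‖ ^ 2)) := by
    intro x hx
    have hpos : 0 < ‖x‖ ^ 2 := by have := norm_pos_iff.2 hx; positivity
    have hφd : HasFDerivAt φ (fderiv ℝ φ x) x := (hφ.differentiable (by simp) x).hasFDerivAt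
    have hNd := (hasStrictFDerivAt_norm_sq x).hasFDerivAt
    have hi : ∀ i, fderiv ℝ (f i) x (EuclideanSpace.single i 1) =
        2 * (φ x * M (‖x‖ ^ 2)) * (gradient φ x i * x i) +
          φ x ^ 2 * (2 * M' (‖x‖ ^ 2) * x i ^ 2 + M (‖x‖ ^ 2)) := by
      intro i
      have hg : fderiv ℝ φ x (EuclideanSpace.single i 1) = gradient φ x i := by
        rw [← toDual_gradient, InnerProductSpace.toDual_apply_apply,
          EuclideanSpace.inner_single_right]
        simp
      have hx3 : HasFDerivAt (fun x : E => x i) (EuclideanSpace.proj (𝕜 := ℝ) i) x :=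
        (EuclideanSpace.proj (𝕜 := ℝ) i).hasFDerivAt
      have := (((hφd.pow 2).mul ((hM _ hpos).comp_hasFDerivAt x hNd)).mul hx3).fderiv
      change fderiv ℝ (f i) x = _ at this
      have h1 : (EuclideanSpace.proj (𝕜 := ℝ) i) (EuclideanSpace.single i (1 : ℝ)) = (1 : ℝ) := by
        simp
      have h2 : inner ℝ x (EuclideanSpace.single i (1 : ℝ)) = x i := by
        rw [EuclideanSpace.inner_single_right]; simp
      rw [this]
      simp [hg, h1, h2]
      ring
    have hin : inner ℝ (gradient φ x) x = ∑ i, gradient φ x i * x i := by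
      rw [PiLp.inner_apply]
      exact Finset.sum_congr rfl fun i _ => by simp [mul_comm]
    rw [Finset.sum_congr rfl fun i _ => hi i, Finset.sum_add_distrib, ← Finset.mul_sum,
      ← Finset.mul_sum, Finset.sum_add_distrib, ← Finset.mul_sum,
      ← EuclideanSpace.real_norm_sq_eq, hin, Finset.sum_const, Finset.card_univ,
      Fintype.card_fin, nsmul_eq_mul]
    ring
  have hsum : ∫ x, ∑ i, fderiv ℝ (f i) x (EuclideanSpace.single i 1) = 0 := by
    rw [integral_finsetSum _ fun i _ => hfi i]
    exact Finset.sum_eq_zero fun i _ => integral_fderiv_apply_eq_zero (hf i) (hfc i) _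
  rw [← hsum]
  refine integral_mono (integrable_finsetSum _ fun i _ => hfi i)
    ((integrable_norm_gradient_sq hφ hφc).add (integrable_mul_sq hQ hφ.continuous hφc hφ0))
    fun x => ?_
  dsimp only
  by_cases hx : x = 0
  · have h1 : ∀ i, fderiv ℝ (f i) x = 0 := fun i => by
      rw [hx, (hfz i).fderiv_eq]; simp
    have h2 : φ x = 0 := by rw [hx]; exact hφz.eq_of_nhds
    simp only [h1, h2]
    simp
  · rw [hdiv x hx]
    -- From |∇φ - φF|² ≥ 0, the divergence 2φ ∇φ·F + φ² div F is at most |∇φ|² + φ²(|F|² + div F).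
    have h1 : 0 ≤ ‖gradient φ x - (φ x * M (‖x‖ ^ 2)) • x‖ ^ 2 := sq_nonneg _
    rw [norm_sub_sq_real, inner_smul_right, norm_smul, mul_pow, Real.norm_eq_abs, sq_abs] at h1
    have h2 := mul_le_mul_of_nonneg_right (h x hx) (sq_nonneg (φ x))
    nlinarith

/-- Subcriticality is tested with smooth weights only; a smooth majorant brings merely continuous
weights within its reach. -/
theorem exists_contDiff_ge {E : Type*} [NormedAddCommGroup E] [NormedSpace ℝ E]
    [FiniteDimensional ℝ E] {w : E → ℝ} (hw : Continuous w)
    (hwc : HasCompactSupport w) :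
    ∃ W : E → ℝ, ContDiff ℝ ∞ W ∧ HasCompactSupport W ∧ ∀ x, w x ≤ W x := by
  obtain ⟨C, hC⟩ := hwc.exists_bound_of_continuous hw
  obtain ⟨R, hR⟩ := hwc.isCompact.isBounded.subset_closedBall 0
  have : HasContDiffBump E := inferInstance
  let b : ContDiffBump (0 : E) := ⟨max R 1, max R 1 + 1, by positivity, by linarith⟩
  have hC0 : 0 ≤ C := (norm_nonneg _).trans (hC 0)
  refine ⟨fun x => C * b x, contDiff_const.mul b.contDiff, b.hasCompactSupport.mul_left,
    fun x => ?_⟩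
  by_cases hx : x ∈ tsupport w
  · have : b x = 1 := b.one_of_mem_closedBall
      (Metric.closedBall_subset_closedBall (le_max_left _ _) (hR hx))
    dsimp only
    rw [this, mul_one]
    exact (le_abs_self _).trans (hC x)
  · rw [image_eq_zero_of_notMem_tsupport hx]
    exact mul_nonneg hC0 b.nonneg

/-! ### The critical coupling constant -/

section threshold

variable {N : ℕ} {Q w : EuclideanSpace ℝ (Fin N) → ℝ}

/-- The form is affine in the potential, so Q - μw - εW dominates (1-t)(Q - εW/(1-t)) + t(Q - μ'w).
The choice t = max(μ, 0)/μ' < 1 also covers negative μ. -/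
theorem IsSubcritical.of_convex_comb (hQ : ContinuousOn Q {0}ᶜ) (hw : Continuous w)
    (hw0 : ∀ x, 0 ≤ w x) (h : IsSubcritical Q) {μ μ' : ℝ} (hμ : μ < μ') (hμ' : 0 < μ')
    (h' : IsNonnegSchrodinger fun x => Q x - μ' * w x) :
    IsSubcritical fun x => Q x - μ * w x := by
  intro W hW hWc
  have cw : ∀ c : ℝ, ContinuousOn (fun x => Q x - c * w x) {0}ᶜ := fun c =>
    hQ.sub (continuous_const.mul hw).continuousOn
  have cW : ∀ c : ℝ, ContinuousOn (fun x => Q x - c * W x) {0}ᶜ := fun c =>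
    hQ.sub (continuous_const.mul hW.continuous).continuousOn
  obtain ⟨ε₀, hε₀, hε⟩ := h W hW hWc
  obtain ⟨t, ht⟩ : ∃ t, t = max μ 0 / μ' := ⟨_, rfl⟩
  have ht0 : 0 ≤ t := by rw [ht]; positivity
  have ht1 : t < 1 := by rw [ht, div_lt_one hμ']; exact max_lt hμ hμ'
  have htμ : μ ≤ t * μ' := by rw [ht, div_mul_cancel₀ _ hμ'.ne']; exact le_max_left _ _
  have ht1' : 0 < 1 - t := by linarith
  refine ⟨ε₀ * (1 - t), by positivity, fun ε hε1 hε2 => ?_⟩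
  have h1 := (hε (ε / (1 - t)) (by positivity) (by rwa [div_lt_iff₀ ht1'])).convex_comb h' (cW _)
    (cw _) ht1'.le ht0 (by ring)
  refine h1.mono (((cW _).const_mul _).add ((cw _).const_mul _))
    ((cw μ).sub (continuous_const.mul hW.continuous).continuousOn) fun x _ => ?_
  have h2 : (1 - t) * (ε / (1 - t) * W x) = ε * W x := by field_simp
  have h3 := mul_le_mul_of_nonneg_right htμ (hw0 x)
  nlinarith

/-- The critical coupling constant of a nonnegative compactly supported weight. -/
theorem IsSubcritical.exists_threshold (hQ : ContinuousOn Q {0}ᶜ) (hw : Continuous w)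
    (hwc : HasCompactSupport w) (hw0 : ∀ x, 0 ≤ w x) (hwpos : ∃ x, x ≠ 0 ∧ w x ≠ 0)
    (h : IsSubcritical Q) :
    ∃ μs : ℝ, 0 < μs ∧ (∀ μ, μ < μs → IsSubcritical fun x => Q x - μ * w x) ∧
      (IsCritical fun x => Q x - μs * w x) ∧
      ∀ μ, μs < μ → IsSupercritical fun x => Q x - μ * w x := by
  have cw : ∀ c : ℝ, ContinuousOn (fun x => Q x - c * w x) {0}ᶜ := fun c =>
    hQ.sub (continuous_const.mul hw).continuousOn
  obtain ⟨W, hW, hWc, hwW⟩ := exists_contDiff_ge hw hwc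
  have cW : ∀ c : ℝ, Continuous fun x => c * W x := fun c => continuous_const.mul hW.continuous
  let S : Set ℝ := {μ | IsNonnegSchrodinger fun x => Q x - μ * w x}
  have hlin : ∀ φ : EuclideanSpace ℝ (Fin N) → ℝ, ContDiff ℝ ∞ φ → HasCompactSupport φ →
      tsupport φ ⊆ {0}ᶜ → ∀ μ : ℝ,
      ∫ x, (‖gradient φ x‖ ^ 2 + (Q x - μ * w x) * φ x ^ 2) =
        (∫ x, (‖gradient φ x‖ ^ 2 + Q x * φ x ^ 2)) - μ * ∫ x, w x * φ x ^ 2 := by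
    intro φ hφ hφc hφ0 μ
    rw [integral_energy (cw μ) hφ hφc hφ0, integral_energy hQ hφ hφc hφ0, add_sub_assoc,
      ← integral_const_mul, ← integral_sub (integrable_mul_sq hQ hφ.continuous hφc hφ0)
        ((integrable_mul_sq hw.continuousOn hφ.continuous hφc hφ0).const_mul μ)]
    congr 2; ext x; ring
  -- A bump around a point x₀ ≠ 0 with w(x₀) > 0 is admissible, and its Rayleigh quotient bounds
  -- every μ in S.
  have hbdd : BddAbove S := by
    obtain ⟨x₀, hx₀, hwx₀⟩ := hwpos
    have hn : 0 < ‖x₀‖ := norm_pos_iff.2 hx₀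
    let b : ContDiffBump x₀ := ⟨‖x₀‖ / 4, ‖x₀‖ / 2, by positivity, by linarith⟩
    have hb0 : tsupport b ⊆ {0}ᶜ := by
      rw [b.tsupport_eq]
      intro x hx
      rw [mem_compl_singleton_iff]
      rintro rfl
      rw [Metric.mem_closedBall, dist_zero_left] at hx
      change ‖x₀‖ ≤ ‖x₀‖ / 2 at hx
      linarith
    have hpos : 0 < ∫ x, w x * b x ^ 2 := by
      refine Continuous.integral_pos_of_hasCompactSupport_nonneg_nonzero (x := x₀)
        (hw.mul (b.continuous.pow 2)) hwc.mul_right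
        (fun x => mul_nonneg (hw0 x) (sq_nonneg _)) ?_
      have : b x₀ = 1 := b.one_of_mem_closedBall (Metric.mem_closedBall_self b.rIn_pos.le)
      simpa [this] using hwx₀
    refine ⟨(∫ x, (‖gradient b x‖ ^ 2 + Q x * b x ^ 2)) / ∫ x, w x * b x ^ 2, fun μ hμ => ?_⟩
    have := hμ b b.contDiff b.hasCompactSupport hb0
    rw [hlin b b.contDiff b.hasCompactSupport hb0] at this
    rw [le_div_iff₀ hpos]; linarith
  have hshift : ∀ μ ε, (IsNonnegSchrodinger fun x => Q x - μ * w x - ε * W x) → 0 < ε →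
      μ + ε ∈ S := by
    intro μ ε hμ hε
    refine hμ.mono ((cw μ).sub (cW ε).continuousOn) (cw _) fun x _ => ?_
    have := mul_le_mul_of_nonneg_left (hwW x) hε.le
    linarith
  obtain ⟨ε₀, hε₀, hε⟩ := h W hW hWc
  have hεS : ε₀ / 2 ∈ S := by
    have := hshift 0 (ε₀ / 2) (by simpa using hε (ε₀ / 2) (by positivity) (by linarith))
      (by positivity)
    simpa using this
  have hspos : 0 < sSup S := lt_of_lt_of_le (by positivity) (le_csSup hbdd hεS)
  have hlt : ∀ μ, μ < sSup S → ∃ μ' ∈ S, μ < μ' ∧ 0 < μ' := fun μ hμ => by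
    obtain ⟨μ', h1, h2⟩ := exists_lt_of_lt_csSup ⟨_, hεS⟩ (max_lt hμ hspos)
    exact ⟨μ', h1, (le_max_left _ _).trans_lt h2, (le_max_right _ _).trans_lt h2⟩
  have hsub : ∀ μ, μ < sSup S → IsSubcritical fun x => Q x - μ * w x := fun μ hμ => by
    obtain ⟨μ', h1, h2, h3⟩ := hlt μ hμ
    exact h.of_convex_comb hQ hw hw0 h2 h3 h1
  refine ⟨sSup S, hspos, hsub, ⟨?_, ?_⟩, fun μ hμ hn => (le_csSup hbdd hn).not_gt hμ⟩
  · intro φ hφ hφc hφ0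
    rw [hlin φ hφ hφc hφ0]
    have ht : Tendsto (fun μ : ℝ => (∫ x, (‖gradient φ x‖ ^ 2 + Q x * φ x ^ 2)) -
        μ * ∫ x, w x * φ x ^ 2) (𝓝[<] sSup S) (𝓝 ((∫ x, (‖gradient φ x‖ ^ 2 + Q x * φ x ^ 2)) -
        sSup S * ∫ x, w x * φ x ^ 2)) := by
      refine Tendsto.mono_left (Continuous.tendsto ?_ _) nhdsWithin_le_nhds
      fun_prop
    refine ge_of_tendsto ht ?_
    filter_upwards [self_mem_nhdsWithin] with μ hμ
    rw [← hlin φ hφ hφc hφ0]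
    exact (hsub μ hμ).isNonneg φ hφ hφc hφ0
  -- Subcriticality at the supremum, tested with the majorant W ≥ w, would put a larger coupling
  -- into S.
  · intro hs
    obtain ⟨ε₁, hε₁, hε'⟩ := hs W hW hWc
    have := hshift (sSup S) (ε₁ / 2) (hε' (ε₁ / 2) (by positivity) (by linarith)) (by positivity)
    linarith [le_csSup hbdd this]

end threshold

theorem exists_radial_threshold {N : ℕ} (hN : 2 ≤ N) {V : ℝ → ℝ} (hV : ContinuousOn V (Ioi 0))
    (h : IsSubcritical (radialPotential N V)) {W : ℝ → ℝ} (hW : ContinuousOn W (Ici 0))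
    (hWc : ∃ R : ℝ, ∀ r : ℝ, R < r → W r = 0) (hW0 : ∀ r : ℝ, 0 ≤ r → 0 ≤ W r)
    (hWpos : ∃ r : ℝ, 0 ≤ r ∧ W r ≠ 0) :
    ∃ μs : ℝ, 0 < μs ∧
      (∀ μ : ℝ, μ < μs → IsSubcritical (radialPotential N fun r => V r - μ * W r)) ∧
      IsCritical (radialPotential N fun r => V r - μs * W r) ∧
      (∀ μ : ℝ, μs < μ → IsSupercritical (radialPotential N fun r => V r - μ * W r)) := by
  have hw : Continuous fun x : EuclideanSpace ℝ (Fin N) => W ‖x‖ :=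
    hW.comp_continuous continuous_norm fun x => norm_nonneg x
  refine IsSubcritical.exists_threshold (Q := radialPotential N V) (w := fun x => W ‖x‖)
    (continuousOn_comp_norm hV) hw ?_ (fun x => hW0 _ (norm_nonneg x)) ?_ h
  · obtain ⟨R, hR⟩ := hWc
    refine HasCompactSupport.intro (isCompact_closedBall 0 R) fun x hx => hR _ ?_
    simpa using hx
  · obtain ⟨r, hr, hWr⟩ := hWpos
    -- The radius where W ≠ 0 might be 0, which test functions do not see; continuity moves it to
    -- the right.
    obtain ⟨s, hs, hWs⟩ : ∃ s, 0 < s ∧ W s ≠ 0 := by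
      have h1 : ∀ᶠ s in 𝓝[>] r, W s ≠ 0 :=
        ((hW r hr).mono (fun s (hs : r < s) => hr.trans hs.le)).eventually_ne hWr
      obtain ⟨s, hs1, hs2⟩ := (h1.and self_mem_nhdsWithin).exists
      exact ⟨s, hr.trans_lt hs2, hs1⟩
    obtain ⟨x, hx⟩ : ∃ x : EuclideanSpace ℝ (Fin N), ‖x‖ = s :=
      ⟨EuclideanSpace.single ⟨0, by omega⟩ s, by simp [abs_of_pos hs]⟩
    exact ⟨x, norm_pos_iff.1 (hx ▸ hs), by rwa [hx]⟩

/-! ### Positivity and rigidity of recessive solutions -/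

theorem IsLineNonneg.comp_neg {q : ℝ → ℝ} (h : IsLineNonneg q) :
    IsLineNonneg fun t => q (-t) := by
  intro φ φ' hφ hφ' hφc
  have := h (fun t => φ (-t)) (fun t => -φ' (-t))
    (fun t => ((hφ (-t)).comp t (hasDerivAt_neg t)).congr_deriv (by ring))
    (by fun_prop) (hφc.comp_homeomorph (Homeomorph.neg ℝ))
  rw [← integral_neg_eq_self] at this
  simpa using this

theorem exists_bound_Ici_of_tendsto {f : ℝ → ℝ} {l : ℝ} (hf : Continuous f)
    (h : Tendsto f atTop (𝓝 l)) (T : ℝ) : ∃ M, ∀ t, T ≤ t → |f t| ≤ M := by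
  obtain ⟨S, hS⟩ := eventually_atTop.1 (h.abs.eventually_lt_const (lt_add_one |l|))
  obtain ⟨M, hM⟩ := (isCompact_Icc (a := T) (b := S)).exists_bound_of_continuousOn hf.continuousOn
  refine ⟨max M (|l| + 1), fun t ht => ?_⟩
  rcases le_total t S with h' | h'
  · exact (hM t ⟨ht, h'⟩).trans (le_max_left _ _)
  · exact (hS t h').le.trans (le_max_right _ _)

namespace IsLineSolution

variable {q v v' u u' : ℝ → ℝ} {κ K : ℝ}

theorem exists_forall_ge_pos (hv1 : Tendsto (fun t => v t * Real.exp (κ * t)) atTop (𝓝 1)) :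
    ∃ T, ∀ t, T ≤ t → 0 < v t := by
  obtain ⟨T, hT⟩ := eventually_atTop.1 (hv1.eventually_const_lt (show (0 : ℝ) < 1 by simp))
  exact ⟨T, fun t ht => pos_of_mul_pos_left (hT t ht) (Real.exp_pos _).le⟩

/-- The limit of u over the dominant profile is a nonzero multiple of the Wronskian with v. If u is
smaller than that profile, the Wronskian vanishes. -/
theorem exists_eq_const_mul (hK : ∀ t, |q t| ≤ K) (hκ : 0 ≤ κ) (hv : IsLineSolution q v v')
    (hv1 : Tendsto (fun t => v t * Real.exp (κ * t)) atTop (𝓝 1)) (hu : IsLineSolution q u u')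
    (h : 0 < κ → Tendsto (fun t => u t * Real.exp (-κ * t)) atTop (𝓝 0))
    (h0 : κ = 0 → Tendsto (fun t => u t / t) atTop (𝓝 0)) : ∃ c, ∀ t, u t = c * v t := by
  have hW : v 0 * u' 0 - v' 0 * u 0 = 0 := by
    rcases hκ.eq_or_lt with hκ | hκ
    · subst hκ
      exact tendsto_nhds_unique (hv.tendsto_div_id (by simpa using hv1) hu) (h0 rfl)
    · have := tendsto_nhds_unique (hv.tendsto_mul_exp_neg hκ hv1 hu) (h hκ)
      rw [div_eq_zero_iff] at this
      exact this.resolve_right (by positivity)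
  obtain ⟨T, hT⟩ := exists_forall_ge_pos hv1
  exact ⟨_, hv.eq_const_mul_of_wronskian_eq_zero hK hu (hT T le_rfl).ne'
    ((hv.wronskian_eq hu T 0).trans hW)⟩

theorem exists_bound_Ici (hκ : 0 ≤ κ) (hv : IsLineSolution q v v')
    (hv1 : Tendsto (fun t => v t * Real.exp (κ * t)) atTop (𝓝 1)) (T : ℝ) :
    ∃ M, ∀ t, T ≤ t → |v t| ≤ M := by
  have cv := hv.continuous
  obtain ⟨M, hM⟩ := exists_bound_Ici_of_tendsto (by fun_prop) hv1 T
  refine ⟨M * Real.exp (-κ * T), fun t ht => ?_⟩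
  have h1 := hM t ht
  have h2 : v t = v t * Real.exp (κ * t) * Real.exp (-κ * t) := by
    rw [mul_assoc, ← Real.exp_add]; simp
  rw [h2, abs_mul, Real.abs_exp]
  have hM0 : 0 ≤ M := (abs_nonneg _).trans h1
  have h3 : Real.exp (-κ * t) ≤ Real.exp (-κ * T) := Real.exp_le_exp.2 (by nlinarith)
  exact mul_le_mul h1 h3 (Real.exp_pos _).le hM0

/-- A recessive solution has no zero if the form is nonnegative. -/
theorem pos_of_isLineNonneg (hq : Continuous q) (hK : ∀ t, |q t| ≤ K) (hqn : IsLineNonneg q)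
    (hκ : 0 ≤ κ) (hv : IsLineSolution q v v')
    (hv1 : Tendsto (fun t => v t * Real.exp (κ * t)) atTop (𝓝 1)) (t : ℝ) : 0 < v t := by
  by_contra hneg
  obtain ⟨T, hT⟩ := exists_forall_ge_pos hv1
  obtain ⟨t₀, h0⟩ : ∃ t₀, v t₀ = 0 := by
    have := mem_range_of_exists_le_of_exists_ge hv.continuous ⟨t, not_lt.1 hneg⟩
      ⟨T, (hT T le_rfl).le⟩
    exact this
  obtain ⟨M, hM⟩ := hv.exists_bound_Ici hκ hv1 t₀
  -- Reflection turns boundedness on [t₀, ∞) into boundedness on a left half-line; the zero is then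
  -- a double zero, and v would vanish identically.
  have h1 := hv.comp_neg.deriv_eq_zero_of_nonneg (by fun_prop) hqn.comp_neg (t₀ := -t₀) (M := M)
    (fun t ht => hM (-t) (by linarith)) (by simpa using h0)
  have := hv.eq_zero_of_initial hK h0 (by simpa using h1) T
  exact (hT T le_rfl).ne' this

/-- The product of the recessive solution with any solution grows at most linearly. -/
theorem tendsto_mul_mul_exp_neg (hκ : 0 ≤ κ) (hv : IsLineSolution q v v')
    (hv1 : Tendsto (fun t => v t * Real.exp (κ * t)) atTop (𝓝 1)) (hu : IsLineSolution q u u') :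
    Tendsto (fun t => v t * u t * Real.exp (-t)) atTop (𝓝 0) := by
  rcases hκ.eq_or_lt with hκ | hκ
  · subst hκ
    have hv1' : Tendsto v atTop (𝓝 1) := by simpa using hv1
    have h1 := hv.tendsto_div_id hv1' hu
    have h2 : Tendsto (fun t : ℝ => t * Real.exp (-t)) atTop (𝓝 0) := by
      simpa using Real.tendsto_pow_mul_exp_neg_atTop_nhds_zero 1
    have := (hv1'.mul h1).mul h2
    rw [mul_zero] at this
    refine this.congr' ?_
    filter_upwards [eventually_gt_atTop 0] with t ht
    field_simp
  · have := (hv1.mul (hv.tendsto_mul_exp_neg hκ hv1 hu)).mul Real.tendsto_exp_neg_atTop_nhds_zero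
    rw [mul_zero] at this
    refine this.congr fun t => ?_
    have : Real.exp (κ * t) * Real.exp (-κ * t) = 1 := by rw [← Real.exp_add]; simp
    linear_combination v t * u t * Real.exp (-t) * this

end IsLineSolution

/-- Exponential convergence at both ends gives a global exponential bound. -/
theorem exists_exponential_bound {p : ℝ → ℝ} (hp : Continuous p) {θ l l' : ℝ} (hθ : 0 < θ)
    (hbot : Tendsto p atBot (𝓝 l'))
    (htop : Tendsto (fun t => Real.exp (θ * t) * |p t - l|) atTop (𝓝 0)) :
    ∃ C, 0 < C ∧ ∀ t, |p t - l| ≤ C * Real.exp (-θ * t) := by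
  obtain ⟨M, hM⟩ := exists_bound_Ici_of_tendsto (by fun_prop) htop 0
  obtain ⟨M', hM'⟩ := exists_bound_Ici_of_tendsto (f := fun t => p (-t) - l) (by fun_prop)
    ((hbot.comp tendsto_neg_atTop_atBot).sub_const l) 0
  refine ⟨max (max M M') 1, by positivity, fun t => ?_⟩
  rcases le_total 0 t with ht | ht
  · have h1 := hM t ht
    rw [abs_mul, abs_abs, Real.abs_exp] at h1
    have h2 : |p t - l| = Real.exp (θ * t) * |p t - l| * Real.exp (-θ * t) := by
      have : Real.exp (θ * t) * Real.exp (-θ * t) = 1 := by rw [← Real.exp_add]; simp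
      linear_combination (-|p t - l|) * this
    rw [h2]
    gcongr
    exact h1.trans ((le_max_left _ _).trans (le_max_left _ _))
  · have h1 := hM' (-t) (by linarith)
    rw [neg_neg] at h1
    have h2 : 1 ≤ Real.exp (-θ * t) := Real.one_le_exp (by nlinarith)
    calc |p t - l| ≤ max (max M M') 1 * 1 := by
          rw [mul_one]; exact h1.trans ((le_max_right _ _).trans (le_max_left _ _))
      _ ≤ _ := by gcongr

/-- Two positive solutions with nonvanishing Wronskian give a strict supersolution of the Riccati
equation. -/
theorem exists_riccati {q v v' u u' : ℝ → ℝ} (hq : Continuous q) (hv : IsLineSolution q v v')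
    (hu : IsLineSolution q u u') (hvp : ∀ t, 0 < v t) (hup : ∀ t, 0 < u t) :
    ∃ y y' : ℝ → ℝ, (∀ t, HasDerivAt y (y' t) t) ∧ Continuous y' ∧
      ∀ t, y' t + y t ^ 2 = q t - (v 0 * u' 0 - v' 0 * u 0) ^ 2 / (4 * (v t * u t) ^ 2) := by
  have cv := hv.continuous
  have cu := hu.continuous
  have cv' := hv.continuous_deriv
  have cu' := hu.continuous_deriv
  -- Each of α = v'/v and β = u'/u solves y' + y² = q. Their mean loses (α - β)²/4, and β - α is the
  -- Wronskian divided by vu.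
  refine ⟨fun t => (v' t / v t + u' t / u t) / 2,
    fun t => ((q t - (v' t / v t) ^ 2) + (q t - (u' t / u t) ^ 2)) / 2, fun t => ?_, ?_,
    fun t => ?_⟩
  · have h1 := (hvp t).ne'
    have h2 := (hup t).ne'
    refine ((((hv.2 t).div (hv.1 t) h1).add ((hu.2 t).div (hu.1 t) h2)).div_const 2).congr_deriv ?_
    field_simp
  · have h1 : Continuous fun t => v' t / v t := cv'.div cv fun t => (hvp t).ne'
    have h2 : Continuous fun t => u' t / u t := cu'.div cu fun t => (hup t).ne'
    fun_prop
  · rw [hv.wronskian_eq hu 0 t]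
    have h1 := (hvp t).ne'
    have h2 := (hup t).ne'
    field_simp
    ring

/-! ### Exponents, and the radial equation on the logarithmic line -/

/-- `κ = √((N-2)² + 4l) / 2`, so that `A^±(l) = -(N-2)/2 ± κ`. -/
noncomputable def halfGap (N : ℕ) (l : ℝ) : ℝ := Real.sqrt (((N : ℝ) - 2) ^ 2 + 4 * l) / 2

theorem halfGap_nonneg (N : ℕ) (l : ℝ) : 0 ≤ halfGap N l := by unfold halfGap; positivity

theorem halfGap_sq {N : ℕ} {l : ℝ} (hl : lambdaStar N ≤ l) :
    halfGap N l ^ 2 = l + (((N : ℝ) - 2) / 2) ^ 2 := by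
  unfold halfGap lambdaStar at *
  rw [div_pow, Real.sq_sqrt (by linarith)]; ring

theorem halfGap_pos {N : ℕ} {l : ℝ} (hl : lambdaStar N < l) : 0 < halfGap N l := by
  unfold halfGap lambdaStar at *
  have := Real.sqrt_pos.2 (show 0 < ((N : ℝ) - 2) ^ 2 + 4 * l by linarith)
  positivity

theorem halfGap_eq_zero {N : ℕ} {l : ℝ} (hl : l = lambdaStar N) : halfGap N l = 0 := by
  refine pow_eq_zero_iff two_ne_zero |>.1 ?_
  rw [halfGap_sq hl.ge, hl, lambdaStar]; ring

theorem rootPlus_eq (N : ℕ) (l : ℝ) : rootPlus N l = -(((N : ℝ) - 2) / 2) + halfGap N l := by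
  unfold rootPlus halfGap; ring

theorem rootMinus_eq (N : ℕ) (l : ℝ) : rootMinus N l = -(((N : ℝ) - 2) / 2) - halfGap N l := by
  unfold rootMinus halfGap; ring

/-- The power r^{(N-2)/2} is the one that removes the first-order term in the variable log r, at the
price of adding ((N-2)/2)² to r²V. -/
theorem IsRadialSolution.isLineSolution {N : ℕ} {V u : ℝ → ℝ} (h : IsRadialSolution N V u) :
    IsLineSolution (linePotential N V) (fun t => Real.exp (((N : ℝ) - 2) / 2 * t) * u (Real.exp t))
      (fun t => Real.exp (((N : ℝ) - 2) / 2 * t) *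
        (((N : ℝ) - 2) / 2 * u (Real.exp t) + Real.exp t * deriv u (Real.exp t))) := by
  obtain ⟨hu, heq⟩ := h
  have hu1 := hu
  rw [show (2 : WithTop ℕ∞) = 1 + 1 by norm_num,
    contDiffOn_succ_iff_deriv_of_isOpen isOpen_Ioi] at hu1
  have hd1 : ∀ r, 0 < r → HasDerivAt u (deriv u r) r := fun r hr =>
    (hu1.1.differentiableAt (Ioi_mem_nhds hr)).hasDerivAt
  have hd2 : ∀ r, 0 < r → HasDerivAt (deriv u) (deriv (deriv u) r) r := fun r hr =>
    ((hu1.2.2.differentiableOn one_ne_zero).differentiableAt (Ioi_mem_nhds hr)).hasDerivAt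
  have hc : ∀ t, HasDerivAt (fun t => u (Real.exp t)) (deriv u (Real.exp t) * Real.exp t) t :=
    fun t => (hd1 _ (Real.exp_pos t)).comp t (Real.hasDerivAt_exp t)
  have hc' : ∀ t, HasDerivAt (fun t => deriv u (Real.exp t))
      (deriv (deriv u) (Real.exp t) * Real.exp t) t :=
    fun t => (hd2 _ (Real.exp_pos t)).comp t (Real.hasDerivAt_exp t)
  have he : ∀ t, HasDerivAt (fun t : ℝ => Real.exp (((N : ℝ) - 2) / 2 * t))
      (((N : ℝ) - 2) / 2 * Real.exp (((N : ℝ) - 2) / 2 * t)) t := fun t =>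
    (((hasDerivAt_id t).const_mul (((N : ℝ) - 2) / 2)).exp).congr_deriv (by simp [mul_comm])
  refine ⟨fun t => ((he t).mul (hc t)).congr_deriv (by ring), fun t => ?_⟩
  refine ((he t).mul (((hc t).const_mul _).add ((Real.hasDerivAt_exp t).mul (hc' t)))).congr_deriv ?_
  have hpos := (Real.exp_pos t).ne'
  have := heq _ (Real.exp_pos t)
  field_simp at this
  simp only [linePotential, Pi.add_apply, Pi.mul_apply]
  linear_combination (Real.exp (((N : ℝ) - 2) / 2 * t) * Real.exp t) * this

theorem IsLineSolution.isRadialSolution {N : ℕ} {V v v' : ℝ → ℝ} (hV : ContinuousOn V (Ioi 0))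
    (h : IsLineSolution (linePotential N V) v v') :
    IsRadialSolution N V (fun r => Real.exp (-(((N : ℝ) - 2) / 2) * Real.log r) * v (Real.log r)) := by
  obtain ⟨a, ha⟩ : ∃ a, a = ((N : ℝ) - 2) / 2 := ⟨_, rfl⟩
  have hN : (N : ℝ) = 2 * a + 2 := by rw [ha]; ring
  rw [← ha]
  let e : ℝ → ℝ := fun r => Real.exp (-a * Real.log r)
  have hl : ∀ r : ℝ, 0 < r → HasDerivAt Real.log r⁻¹ r := fun r hr => Real.hasDerivAt_log hr.ne'
  have he : ∀ r, 0 < r → HasDerivAt e (e r * (-a * r⁻¹)) r := fun r hr =>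
    ((hl r hr).const_mul (-a)).exp
  have hv : ∀ r, 0 < r → HasDerivAt (fun r => v (Real.log r)) (v' (Real.log r) * r⁻¹) r :=
    fun r hr => (h.1 _).comp r (hl r hr)
  have hv' : ∀ r, 0 < r → HasDerivAt (fun r => v' (Real.log r))
      (linePotential N V (Real.log r) * v (Real.log r) * r⁻¹) r :=
    fun r hr => (h.2 _).comp r (hl r hr)
  let u : ℝ → ℝ := fun r => e r * v (Real.log r)
  let u' : ℝ → ℝ := fun r => e r * (v' (Real.log r) - a * v (Real.log r)) * r⁻¹
  have hu : ∀ r, 0 < r → HasDerivAt u (u' r) r := fun r hr =>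
    ((he r hr).mul (hv r hr)).congr_deriv (by simp only [u']; ring)
  have hu' : ∀ r, 0 < r → HasDerivAt u' (V r * u r - ((N : ℝ) - 1) / r * u' r) r := by
    intro r hr
    refine (((he r hr).mul ((hv' r hr).sub ((hv r hr).const_mul a))).mul
      (hasDerivAt_inv hr.ne')).congr_deriv ?_
    simp only [u', u, linePotential, Real.exp_log hr, hN, Pi.sub_apply, Pi.mul_apply]
    field_simp
    ring
  have hdu : ∀ r, 0 < r → deriv u r = u' r := fun r hr => (hu r hr).deriv
  have hddu : ∀ r, 0 < r → deriv (deriv u) r = V r * u r - ((N : ℝ) - 1) / r * u' r := by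
    intro r hr
    have : deriv u =ᶠ[𝓝 r] u' := by
      filter_upwards [Ioi_mem_nhds hr] with s hs using hdu s hs
    rw [this.deriv_eq, (hu' r hr).deriv]
  change IsRadialSolution N V u
  refine ⟨?_, fun r hr => ?_⟩
  · have cu : ContinuousOn u (Ioi 0) := fun r hr => (hu r hr).continuousAt.continuousWithinAt
    have cu' : ContinuousOn u' (Ioi 0) := fun r hr => (hu' r hr).continuousAt.continuousWithinAt
    rw [show (2 : WithTop ℕ∞) = 1 + 1 by norm_num, contDiffOn_succ_iff_deriv_of_isOpen isOpen_Ioi]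
    refine ⟨fun r hr => (hu r hr).differentiableAt.differentiableWithinAt, by simp, ?_⟩
    rw [show (1 : WithTop ℕ∞) = 0 + 1 by simp, contDiffOn_succ_iff_deriv_of_isOpen isOpen_Ioi]
    refine ⟨fun r hr => ?_, by simp, ?_⟩
    · have : deriv u =ᶠ[𝓝 r] u' := by
        filter_upwards [Ioi_mem_nhds hr] with s hs using hdu s hs
      exact (this.differentiableAt_iff.2 (hu' r hr).differentiableAt).differentiableWithinAt
    · rw [contDiffOn_zero]
      refine ContinuousOn.congr (f := fun r => V r * u r - ((N : ℝ) - 1) / r * u' r) ?_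
        fun r hr => hddu r hr
      exact (hV.mul cu).sub ((continuousOn_const.div continuousOn_id fun r hr => hr.ne').mul cu')
  · rw [hddu r hr, hdu r hr]; ring

/-! ### Criteria for subcriticality and its failure -/

/-- The field F(x) = (y(log|x|) - a) x/|x|², with a = (N-2)/2, satisfies div F + |F|² = V -
k(log|x|)/|x|². The lower bound on k makes k(log|x|)/|x|² at least a positive constant on each ball,
up to the origin, so it dominates εW for small ε. -/
theorem isSubcritical_of_riccati {N : ℕ} {V : ℝ → ℝ} (hV : ContinuousOn V (Ioi 0))
    {y y' k : ℝ → ℝ} (hy : ∀ t, HasDerivAt y (y' t) t) (hy' : Continuous y')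
    (hyk : ∀ t, y' t + y t ^ 2 = linePotential N V t - k t)
    (hk : ∀ T, ∃ c, 0 < c ∧ ∀ t, t ≤ T → c * Real.exp t ^ 2 ≤ k t) :
    IsSubcritical (radialPotential N V) := by
  intro W hW hWc
  obtain ⟨C, hC⟩ := hWc.exists_bound_of_continuous hW.continuous
  obtain ⟨R, hR⟩ := hWc.isCompact.isBounded.subset_closedBall 0
  obtain ⟨c, hc, hck⟩ := hk (Real.log (max R 1))
  have hC0 : 0 ≤ C := (norm_nonneg _).trans (hC 0)
  refine ⟨c / (C + 1), by positivity, fun ε hε1 hε2 => ?_⟩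
  obtain ⟨a, ha⟩ : ∃ a, a = ((N : ℝ) - 2) / 2 := ⟨_, rfl⟩
  have hN : (N : ℝ) = 2 * a + 2 := by rw [ha]; ring
  have hkc : Continuous y := continuous_of_hasDerivAt hy
  refine isNonnegSchrodinger_of_divergence_le
    (M := fun s => (y (Real.log s / 2) - a) / s)
    (M' := fun s => y' (Real.log s / 2) / (2 * s ^ 2) - (y (Real.log s / 2) - a) / s ^ 2)
    ((continuousOn_comp_norm hV).sub (continuous_const.mul hW.continuous).continuousOn)
    (fun s hs => ?_) ?_ fun x hx => ?_
  · refine ((((hy _).comp s ((Real.hasDerivAt_log hs.ne').div_const 2)).sub_const a).div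
      (hasDerivAt_id s) hs.ne').congr_deriv ?_
    simp only [Function.comp, id]
    field_simp
  · have hl : ContinuousOn (fun s => Real.log s / 2) (Ioi 0) :=
      (Real.continuousOn_log.mono fun s hs => ne_of_gt hs).div_const 2
    have h1 := hkc.comp_continuousOn hl
    have h2 := hy'.comp_continuousOn hl
    exact (h2.div (continuousOn_const.mul (continuousOn_id.pow 2)) fun s hs => by
      have : s ≠ 0 := ne_of_gt hs
      simpa using this).sub ((h1.sub continuousOn_const).div (continuousOn_id.pow 2) fun s hs => by
      have : s ≠ 0 := ne_of_gt hs
      simpa using this)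
  · have hx0 : 0 < ‖x‖ := norm_pos_iff.2 hx
    have hlog : Real.log (‖x‖ ^ 2) / 2 = Real.log ‖x‖ := by rw [Real.log_pow]; push_cast; ring
    have hexp : Real.exp (Real.log ‖x‖) = ‖x‖ := Real.exp_log hx0
    have h1 := hyk (Real.log ‖x‖)
    have hk0 : ε * W x * ‖x‖ ^ 2 ≤ k (Real.log ‖x‖) := by
      by_cases hxR : ‖x‖ ≤ max R 1
      · have h2 := hck (Real.log ‖x‖) (Real.log_le_log hx0 hxR)
        rw [hexp] at h2
        refine le_trans ?_ h2
        gcongr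
        calc ε * W x ≤ ε * (C + 1) := by
              gcongr; linarith [(le_abs_self _).trans (hC x)]
          _ ≤ c := by rw [lt_div_iff₀ (by positivity)] at hε2; exact hε2.le
      · have h3 : x ∉ tsupport W := fun h => hxR (le_max_of_le_left (by simpa using hR h))
        rw [image_eq_zero_of_notMem_tsupport h3, mul_zero, zero_mul]
        obtain ⟨c', hc', h4⟩ := hk (Real.log ‖x‖)
        exact le_trans (by positivity) (h4 _ le_rfl)
    simp only [hlog, radialPotential]
    rw [linePotential, hexp, ← ha] at h1
    generalize y (Real.log ‖x‖) = Y at *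
    generalize y' (Real.log ‖x‖) = Y' at *
    have h5 : (N : ℝ) * ((Y - a) / ‖x‖ ^ 2) + 2 * ‖x‖ ^ 2 * (Y' / (2 * (‖x‖ ^ 2) ^ 2) -
        (Y - a) / (‖x‖ ^ 2) ^ 2) + ‖x‖ ^ 2 * ((Y - a) / ‖x‖ ^ 2) ^ 2 =
        V ‖x‖ - k (Real.log ‖x‖) / ‖x‖ ^ 2 := by
      rw [hN]
      field_simp
      linear_combination h1
    rw [h5]
    have h6 : ε * W x ≤ k (Real.log ‖x‖) / ‖x‖ ^ 2 := by rwa [le_div_iff₀ (by positivity)]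
    linarith

/-- One smooth radial well positive on |x|² < 2 suffices: on the line it is a nonnegative k,
positive for t in [-1, 0], and a bounded positive solution leaves no room to subtract it. -/
theorem not_isSubcritical_of_bounded_solution {N : ℕ} (hN : 2 ≤ N) {V v v' : ℝ → ℝ}
    (hV : ContinuousOn V (Ioi 0)) (hv : IsLineSolution (linePotential N V) v v') {M : ℝ}
    (hM : ∀ t, |v t| ≤ M) (hpos : ∀ t, 0 < v t) : ¬ IsSubcritical (radialPotential N V) := by
  intro h
  have hS : Continuous fun r : ℝ => Real.smoothTransition (2 - r ^ 2) :=
    Real.smoothTransition.continuous.comp (by fun_prop)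
  obtain ⟨ε₀, hε₀, hε⟩ := h (fun x => Real.smoothTransition (2 - ‖x‖ ^ 2))
    (Real.smoothTransition.contDiff.comp (contDiff_const.sub (contDiff_norm_sq ℝ))) (by
      refine HasCompactSupport.intro (isCompact_closedBall 0 2) fun x hx => ?_
      have : 2 < ‖x‖ := by simpa using hx
      exact Real.smoothTransition.zero_of_nonpos (by nlinarith))
  have h1 : IsNonnegSchrodinger (radialPotential N fun r =>
      V r - ε₀ / 2 * Real.smoothTransition (2 - r ^ 2)) :=
    hε (ε₀ / 2) (by positivity) (by linarith)
  have h2 : IsLineNonneg (linePotential N fun r =>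
      V r - ε₀ / 2 * Real.smoothTransition (2 - r ^ 2)) :=
    h1.isLineNonneg hN (hV.sub (continuous_const.mul hS).continuousOn)
  let k : ℝ → ℝ := fun t => ε₀ / 2 * (Real.exp t ^ 2 * Real.smoothTransition (2 - Real.exp t ^ 2))
  have hk : Continuous k :=
    continuous_const.mul ((Real.continuous_exp.pow 2).mul (hS.comp Real.continuous_exp))
  have h3 : linePotential N (fun r => V r - ε₀ / 2 * Real.smoothTransition (2 - r ^ 2)) =
      fun t => linePotential N V t - k t := by
    ext t; simp only [linePotential, k]; ring
  rw [h3] at h2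
  refine hv.not_isLineNonneg_sub (continuous_linePotential N hV) hk hM (fun t => ?_)
    (neg_one_lt_zero) (fun t ht => ?_) (fun t _ => (hpos t).ne') h2
  · have := Real.smoothTransition.nonneg (2 - Real.exp t ^ 2)
    simp only [k]; positivity
  · have h4 : Real.exp t ≤ 1 := Real.exp_le_one_iff.2 ht.2
    have h5 : 0 < Real.smoothTransition (2 - Real.exp t ^ 2) :=
      Real.smoothTransition.pos_of_pos (by nlinarith [Real.exp_pos t])
    simp only [k]; positivity

theorem tendsto_nhdsGT_zero_iff_exp_neg {f : ℝ → ℝ} {l : Filter ℝ} :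
    Tendsto f (𝓝[>] 0) l ↔ Tendsto (fun t => f (Real.exp (-t))) atTop l := by
  rw [← Real.tendsto_comp_exp_atBot, ← map_neg_atTop, tendsto_map'_iff]
  rfl

theorem tendsto_of_tendsto_exp_mul_abs_sub {f : ℝ → ℝ} {θ l : ℝ} (hθ : 0 < θ)
    (h : Tendsto (fun t => Real.exp (θ * t) * |f t - l|) atTop (𝓝 0)) : Tendsto f atTop (𝓝 l) := by
  have h1 := (tendsto_exp_neg_mul hθ).mul h
  rw [zero_mul] at h1
  have h2 : Tendsto (fun t => |f t - l|) atTop (𝓝 0) := h1.congr fun t => by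
    have : Real.exp (-θ * t) * Real.exp (θ * t) = 1 := by rw [← Real.exp_add]; simp
    linear_combination |f t - l| * this
  have h3 := (tendsto_zero_iff_abs_tendsto_zero _).2 h2
  simpa using h3.add_const l

theorem div_exp_rpow (a b s x : ℝ) :
    x / Real.exp s ^ (-a + b) = Real.exp (a * s) * x * Real.exp (-b * s) := by
  rw [← Real.exp_mul, div_eq_mul_inv, ← Real.exp_neg, mul_comm (Real.exp (a * s)), mul_assoc,
    ← Real.exp_add]
  ring_nf

/-- The Riccati gain is W₀²/(4v²u²) with u = z(-·). As t → -∞ the recessive and dominant rates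
cancel in vu, leaving at most linear growth, so vu e^t ≤ M for t ≤ T and the gain is at least
W₀²/(4M²) · e^{2t}. -/
theorem isSubcritical_of_wronskian_ne_zero {N : ℕ} {V z z' v v' : ℝ → ℝ} {κ : ℝ}
    (hV : ContinuousOn V (Ioi 0)) (hκ : 0 ≤ κ)
    (hz : IsLineSolution (fun t => linePotential N V (-t)) z z')
    (hz1 : Tendsto (fun t => z t * Real.exp (κ * t)) atTop (𝓝 1))
    (hu : IsLineSolution (linePotential N V) (fun t => z (-t)) (fun t => -z' (-t)))
    (hv : IsLineSolution (linePotential N V) v v')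
    (hzp : ∀ t, 0 < z t) (hvp : ∀ t, 0 < v t) (hW : v 0 * -z' (-0) - v' 0 * z (-0) ≠ 0) :
    IsSubcritical (radialPotential N V) := by
  obtain ⟨y, y', hy, hy', hyk⟩ := exists_riccati (continuous_linePotential N hV) hv hu hvp
    (fun t => hzp (-t))
  refine isSubcritical_of_riccati hV hy hy' hyk fun T => ?_
  set W₀ := v 0 * -z' (-0) - v' 0 * z (-0)
  have cz := hz.continuous
  have cv := hv.continuous
  obtain ⟨M, hM⟩ := exists_bound_Ici_of_tendsto (by fun_prop)
    (hz.tendsto_mul_mul_exp_neg hκ hz1 hv.comp_neg) (-T)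
  have hM' : ∀ t, t ≤ T → v t * z (-t) * Real.exp t ≤ M := fun t ht => by
    have := (le_abs_self _).trans (hM (-t) (by linarith))
    rw [neg_neg] at this
    rwa [mul_comm (v t)]
  have hM0 : 0 < M := lt_of_lt_of_le
    (mul_pos (mul_pos (hvp T) (hzp (-T))) (Real.exp_pos T)) (hM' T le_rfl)
  refine ⟨W₀ ^ 2 / (4 * M ^ 2), by positivity, fun t ht => ?_⟩
  have h1 := hvp t
  have h2 := hzp (-t)
  rw [le_div_iff₀ (by positivity), div_mul_eq_mul_div, div_mul_eq_mul_div,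
    div_le_iff₀ (by positivity)]
  have h3 : (v t * z (-t) * Real.exp t) ^ 2 ≤ M ^ 2 := by
    have := hM' t ht
    gcongr
  nlinarith [mul_le_mul_of_nonneg_left h3 (sq_nonneg W₀)]

/-! ### Assembly of the theorem -/

theorem theorem1p1 (N : ℕ) (hN : 2 ≤ N) (V : ℝ → ℝ) (hV : ContinuousOn V (Ioi 0))
    (l₁ l₂ θ : ℝ) (hl₁ : lambdaStar N ≤ l₁) (hl₂ : lambdaStar N ≤ l₂) (hθ : 0 < θ)
    (hV0 : Tendsto (fun r : ℝ => r ^ (-θ) * |r ^ 2 * V r - l₁|) (𝓝[>] 0) (𝓝 0))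
    (hVinf : Tendsto (fun r : ℝ => r ^ θ * |r ^ 2 * V r - l₂|) atTop (𝓝 0)) :
    (∃ U : ℝ → ℝ,
      -- (1) existence and uniqueness on `(0,∞)`
      (IsRadialSolution N V U ∧
        Tendsto (fun r : ℝ => U r / r ^ rootPlus N l₁) (𝓝[>] 0) (𝓝 1)) ∧
      (∀ w : ℝ → ℝ, IsRadialSolution N V w →
        Tendsto (fun r : ℝ => w r / r ^ rootPlus N l₁) (𝓝[>] 0) (𝓝 1) →
        EqOn w U (Ioi 0)) ∧
      -- (2)
      (∀ w : ℝ → ℝ, IsRadialSolution N V w →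
        (lambdaStar N < l₁ → w =o[𝓝[>] 0] fun r : ℝ => r ^ rootMinus N l₁) →
        (l₁ = lambdaStar N →
          w =o[𝓝[>] 0] fun r : ℝ => r ^ (-((N : ℝ) - 2) / 2) * |Real.log r|) →
        ∃ c : ℝ, ∀ r : ℝ, 0 < r → w r = c * U r) ∧
      -- (3)
      (IsNonnegSchrodinger (radialPotential N V) →
        (∀ r : ℝ, 0 < r → 0 < U r) ∧
        (IsSubcritical (radialPotential N V) → lambdaStar N < l₂ →
          ∃ c : ℝ, 0 < c ∧
            Tendsto (fun r : ℝ => U r / (c * r ^ rootPlus N l₂)) atTop (𝓝 1)) ∧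
        (IsCritical (radialPotential N V) → lambdaStar N < l₂ →
          ∃ c : ℝ, 0 < c ∧
            Tendsto (fun r : ℝ => U r / (c * r ^ rootMinus N l₂)) atTop (𝓝 1)) ∧
        (IsSubcritical (radialPotential N V) → l₂ = lambdaStar N →
          ∃ c : ℝ, 0 < c ∧
            Tendsto (fun r : ℝ => U r / (c * (r ^ (-((N : ℝ) - 2) / 2) * Real.log r)))
              atTop (𝓝 1)) ∧
        (IsCritical (radialPotential N V) → l₂ = lambdaStar N →
          ∃ c : ℝ, 0 < c ∧
            Tendsto (fun r : ℝ => U r / (c * r ^ (-((N : ℝ) - 2) / 2))) atTop (𝓝 1)))) ∧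
    -- (4)
    (IsSubcritical (radialPotential N V) →
      ∀ W : ℝ → ℝ, ContinuousOn W (Ici 0) → (∃ R : ℝ, ∀ r : ℝ, R < r → W r = 0) →
        (∀ r : ℝ, 0 ≤ r → 0 ≤ W r) → (∃ r : ℝ, 0 ≤ r ∧ W r ≠ 0) →
        ∃ μs : ℝ, 0 < μs ∧
          (∀ μ : ℝ, μ < μs → IsSubcritical (radialPotential N fun r => V r - μ * W r)) ∧
          IsCritical (radialPotential N fun r => V r - μs * W r) ∧
          (∀ μ : ℝ, μs < μ → IsSupercritical (radialPotential N fun r => V r - μ * W r))) := by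
  refine ⟨?_, fun h W hW hWc hW0 hWpos => exists_radial_threshold hN hV h hW hWc hW0 hWpos⟩
  obtain ⟨a, ha⟩ : ∃ a, a = ((N : ℝ) - 2) / 2 := ⟨_, rfl⟩
  obtain ⟨q, hqdef⟩ : ∃ q, q = linePotential N V := ⟨_, rfl⟩
  obtain ⟨κ₁, hκ₁⟩ : ∃ κ, κ = halfGap N l₁ := ⟨_, rfl⟩
  obtain ⟨κ₂, hκ₂⟩ : ∃ κ, κ = halfGap N l₂ := ⟨_, rfl⟩
  have hκ₁0 : 0 ≤ κ₁ := hκ₁ ▸ halfGap_nonneg N l₁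
  have hκ₂0 : 0 ≤ κ₂ := hκ₂ ▸ halfGap_nonneg N l₂
  have hA₁ : rootPlus N l₁ = -a + κ₁ := by rw [rootPlus_eq, ha, hκ₁]
  have hB₁ : rootMinus N l₁ = -a + -κ₁ := by rw [rootMinus_eq, ha, hκ₁]; ring
  have hA₂ : rootPlus N l₂ = -a + κ₂ := by rw [rootPlus_eq, ha, hκ₂]
  have hB₂ : rootMinus N l₂ = -a + -κ₂ := by rw [rootMinus_eq, ha, hκ₂]; ring
  have hA0 : -((N : ℝ) - 2) / 2 = -a + 0 := by rw [ha]; ring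
  have hq : Continuous q := hqdef ▸ continuous_linePotential N hV
  let p : ℝ → ℝ := fun t => q t - a ^ 2
  have hp : ∀ t, p t = Real.exp t ^ 2 * V (Real.exp t) := fun t => by
    simp only [p, hqdef, linePotential, ha]; ring
  have hpc : Continuous p := hq.sub continuous_const
  have htop : Tendsto (fun t => Real.exp (θ * t) * |p t - l₂|) atTop (𝓝 0) := by
    refine (Real.tendsto_comp_exp_atTop.2 hVinf).congr fun t => ?_
    rw [hp, ← Real.exp_mul, mul_comm t]
  have hbot : Tendsto (fun t => Real.exp (θ * t) * |p (-t) - l₁|) atTop (𝓝 0) := by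
    refine (tendsto_nhdsGT_zero_iff_exp_neg.1 hV0).congr fun t => ?_
    rw [hp, ← Real.exp_mul, neg_mul_neg, mul_comm t]
  have htop' := tendsto_of_tendsto_exp_mul_abs_sub hθ htop
  have hbot' : Tendsto (fun t => p (-t)) atTop (𝓝 l₁) := tendsto_of_tendsto_exp_mul_abs_sub hθ hbot
  -- The fixed point needs the bound at every t. Towards the opposite end the exponential is at
  -- least 1, so boundedness of p is enough there.
  obtain ⟨C₂, hC₂, hb₂⟩ := exists_exponential_bound hpc hθ (l' := l₁)
    ((hbot'.comp tendsto_neg_atBot_atTop).congr fun t => by simp) htop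
  obtain ⟨C₁, hC₁, hb₁⟩ := exists_exponential_bound (p := fun t => p (-t)) (by fun_prop) hθ
    (l' := l₂) (htop'.comp tendsto_neg_atBot_atTop) hbot
  have hqκ₂ : ∀ t, |q t - κ₂ ^ 2| ≤ C₂ * Real.exp (-θ * t) := fun t => by
    have e : q t - κ₂ ^ 2 = p t - l₂ := by
      rw [hκ₂, halfGap_sq hl₂, ← ha]; simp only [p]; ring
    rw [e]; exact hb₂ t
  have hqκ₁ : ∀ t, |q (-t) - κ₁ ^ 2| ≤ C₁ * Real.exp (-θ * t) := fun t => by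
    have e : q (-t) - κ₁ ^ 2 = p (-t) - l₁ := by
      rw [hκ₁, halfGap_sq hl₁, ← ha]; simp only [p]; ring
    rw [e]; exact hb₁ t
  obtain ⟨K, hK⟩ : ∃ K, ∀ t, |q t| ≤ K := by
    have hdec : ∀ t : ℝ, 0 ≤ t → Real.exp (-θ * t) ≤ 1 := fun t ht =>
      Real.exp_le_one_iff.2 (by nlinarith)
    refine ⟨κ₁ ^ 2 + κ₂ ^ 2 + C₁ + C₂, fun t => ?_⟩
    rcases le_total 0 t with ht | ht
    · have h1 := abs_le.1 ((hqκ₂ t).trans (mul_le_of_le_one_right hC₂.le (hdec t ht)))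
      rw [abs_le]; constructor <;> nlinarith
    · have h1 := abs_le.1 ((hqκ₁ (-t)).trans
        (mul_le_of_le_one_right hC₁.le (hdec (-t) (by linarith))))
      rw [neg_neg] at h1
      rw [abs_le]; constructor <;> nlinarith
  obtain ⟨z, z', hz, hz1⟩ := exists_recessive_solution (q := fun t => q (-t)) (by fun_prop) hκ₁0
    hθ hC₁ hqκ₁
  obtain ⟨v, v', hv, hv1⟩ := exists_recessive_solution hq hκ₂0 hθ hC₂ hqκ₂
  have hu : IsLineSolution q (fun t => z (-t)) (fun t => -z' (-t)) := by
    simpa only [neg_neg] using hz.comp_neg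
  let U : ℝ → ℝ := fun r => Real.exp (-a * Real.log r) * z (-Real.log r)
  have hU : IsRadialSolution N V U := by
    have : IsLineSolution (linePotential N V) _ _ := hqdef ▸ hu
    have := this.isRadialSolution hV
    rwa [← ha] at this
  have hUexp : ∀ t, Real.exp (a * t) * U (Real.exp t) = z (-t) := fun t => by
    have : Real.exp (a * t) * Real.exp (-a * t) = 1 := by rw [← Real.exp_add]; simp
    simp only [U, Real.log_exp]
    linear_combination z (-t) * this
  have hU1 : Tendsto (fun r : ℝ => U r / r ^ rootPlus N l₁) (𝓝[>] 0) (𝓝 1) := by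
    rw [tendsto_nhdsGT_zero_iff_exp_neg]
    refine hz1.congr fun t => ?_
    rw [hA₁, div_exp_rpow, hUexp]
    simp
  -- Uniqueness and (2) both reduce to this: a solution below the dominant profile at the origin is
  -- a multiple of U.
  have core : ∀ w : ℝ → ℝ, IsRadialSolution N V w →
      (0 < κ₁ → Tendsto (fun t => Real.exp (a * -t) * w (Real.exp (-t)) * Real.exp (-κ₁ * t))
        atTop (𝓝 0)) →
      (κ₁ = 0 → Tendsto (fun t => Real.exp (a * -t) * w (Real.exp (-t)) / t) atTop (𝓝 0)) →
      ∃ c : ℝ, ∀ r : ℝ, 0 < r → w r = c * U r := by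
    intro w hw h1 h2
    have hwl := hw.isLineSolution.comp_neg
    rw [← hqdef, ← ha] at hwl
    obtain ⟨c, hc⟩ := hz.exists_eq_const_mul (fun t => hK (-t)) hκ₁0 hz1 hwl h1 h2
    refine ⟨c, fun r hr => ?_⟩
    have h3 := hc (-Real.log r)
    simp only [neg_neg, Real.exp_log hr] at h3
    have h4 : Real.exp (a * Real.log r) * Real.exp (-a * Real.log r) = 1 := by
      rw [← Real.exp_add]; simp
    simp only [U]
    linear_combination Real.exp (-a * Real.log r) * h3 - w r * h4
  refine ⟨U, ⟨hU, hU1⟩, fun w hw hw1 => ?_, fun w hw hw1 hw2 => ?_, fun hnn => ?_⟩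
  · have hw1' : Tendsto (fun t => Real.exp (a * -t) * w (Real.exp (-t)) * Real.exp (κ₁ * t)) atTop
        (𝓝 1) := by
      refine (tendsto_nhdsGT_zero_iff_exp_neg.1 hw1).congr fun t => ?_
      rw [hA₁, div_exp_rpow]
      simp
    -- A function with the recessive asymptotics is below the dominant profile; comparing the limits
    -- then forces c = 1.
    obtain ⟨c, hc⟩ := core w hw (fun hpos => by
      have := hw1'.mul (tendsto_exp_neg_mul (θ := 2 * κ₁) (by positivity))
      rw [mul_zero] at this
      refine this.congr fun t => ?_
      rw [mul_assoc, ← Real.exp_add]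
      ring_nf) (fun h0 => by
      have := hw1'.mul tendsto_inv_atTop_zero
      rw [mul_zero] at this
      refine this.congr fun t => ?_
      rw [h0]; simp [div_eq_mul_inv])
    have h1 : Tendsto (fun r : ℝ => w r / r ^ rootPlus N l₁) (𝓝[>] 0) (𝓝 (c * 1)) := by
      refine (hU1.const_mul c).congr' ?_
      filter_upwards [self_mem_nhdsWithin] with r hr
      rw [hc r hr]
      exact (mul_div_assoc _ _ _).symm
    have h2 := tendsto_nhds_unique h1 hw1
    intro r hr
    rw [hc r hr, show c = 1 by linarith, one_mul]
  · refine core w hw (fun hpos => ?_) (fun h0 => ?_)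
    · have hl : lambdaStar N < l₁ := by
        refine lt_of_le_of_ne hl₁ fun h => ?_
        rw [hκ₁, halfGap_eq_zero h.symm] at hpos
        exact lt_irrefl _ hpos
      refine (tendsto_nhdsGT_zero_iff_exp_neg.1 (hw1 hl).tendsto_div_nhds_zero).congr fun t => ?_
      rw [hB₁, div_exp_rpow]
      simp
    · have hl : l₁ = lambdaStar N := by
        by_contra h
        have := halfGap_pos (lt_of_le_of_ne hl₁ (Ne.symm h))
        rw [← hκ₁, h0] at this
        exact lt_irrefl _ this
      refine (tendsto_nhdsGT_zero_iff_exp_neg.1 (hw2 hl).tendsto_div_nhds_zero).congr' ?_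
      filter_upwards [eventually_gt_atTop 0] with t ht
      rw [hA0, ← div_div, div_exp_rpow, Real.log_exp, abs_neg, abs_of_pos ht]
      simp
  · have hqn : IsLineNonneg q := hqdef ▸ hnn.isLineNonneg hN hV
    have hzp : ∀ t, 0 < z t := hz.pos_of_isLineNonneg (by fun_prop) (fun t => hK (-t))
      hqn.comp_neg hκ₁0 hz1
    have hvp : ∀ t, 0 < v t := hv.pos_of_isLineNonneg hq hK hqn hκ₂0 hv1
    -- The Wronskian of the recessive solutions at the two ends: it vanishes exactly when they are
    -- proportional.
    obtain ⟨W₀, hW₀⟩ : ∃ W₀, W₀ = v 0 * -z' (-0) - v' 0 * z (-0) := ⟨_, rfl⟩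
    have hprop : W₀ = 0 → ∃ c, 0 < c ∧ ∀ t, z (-t) = c * v t := fun h0 =>
      ⟨_, div_pos (hzp _) (hvp 0),
        hv.eq_const_mul_of_wronskian_eq_zero hK hu (hvp 0).ne' (hW₀ ▸ h0)⟩
    -- If W₀ = 0, the line solution is controlled at -∞ by z and at +∞ by cv, hence bounded.
    have hsub : IsSubcritical (radialPotential N V) → W₀ ≠ 0 := by
      intro hs h0
      obtain ⟨c, hc, hcv⟩ := hprop h0
      obtain ⟨M₁, hM₁⟩ := hz.exists_bound_Ici hκ₁0 hz1 0
      obtain ⟨M₂, hM₂⟩ := hv.exists_bound_Ici hκ₂0 hv1 0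
      refine not_isSubcritical_of_bounded_solution hN hV (hqdef ▸ hu) (M := max M₁ (c * M₂))
        (fun t => ?_) (fun t => hzp (-t)) hs
      rcases le_total 0 t with ht | ht
      · rw [hcv, abs_mul, abs_of_pos hc]
        exact (mul_le_mul_of_nonneg_left (hM₂ t ht) hc.le).trans (le_max_right _ _)
      · exact (hM₁ (-t) (by linarith)).trans (le_max_left _ _)
    have hcrit : IsCritical (radialPotential N V) → W₀ = 0 := by
      intro hc
      by_contra h0
      exact hc.2 (isSubcritical_of_wronskian_ne_zero hV hκ₁0 (hqdef ▸ hz) hz1 (hqdef ▸ hu)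
        (hqdef ▸ hv) hzp hvp (hW₀ ▸ h0))
    have hfin : ∀ b c : ℝ, 0 < c → Tendsto (fun t => z (-t) * Real.exp (-b * t)) atTop (𝓝 c) →
        Tendsto (fun r : ℝ => U r / (c * r ^ (-a + b))) atTop (𝓝 1) := by
      intro b c hc h
      rw [← Real.tendsto_comp_exp_atTop]
      have := h.div_const c
      rw [div_self hc.ne'] at this
      refine this.congr fun t => ?_
      rw [mul_comm c, ← div_div, div_exp_rpow, hUexp]
    have hrec : W₀ = 0 → ∃ c, 0 < c ∧
        Tendsto (fun t => z (-t) * Real.exp (κ₂ * t)) atTop (𝓝 c) := by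
      intro h0
      obtain ⟨c, hc, hcv⟩ := hprop h0
      refine ⟨c, hc, ?_⟩
      have := hv1.const_mul c
      rw [mul_one] at this
      refine this.congr fun t => ?_
      rw [hcv]; ring
    refine ⟨fun r hr => mul_pos (Real.exp_pos _) (hzp _), fun hs hl => ?_, fun hc hl => ?_,
      fun hs hl => ?_, fun hc hl => ?_⟩
    · have hκ : 0 < κ₂ := hκ₂ ▸ halfGap_pos hl
      have h1 := hv.tendsto_mul_exp_neg hκ hv1 hu
      rw [← hW₀] at h1
      -- Positivity of U fixes the sign of the limit; subcriticality excludes zero.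
      have h2 : 0 ≤ W₀ / (2 * κ₂) :=
        ge_of_tendsto' h1 fun t => (mul_pos (hzp _) (Real.exp_pos _)).le
      have h3 : 0 < W₀ / (2 * κ₂) :=
        lt_of_le_of_ne h2 (div_ne_zero (hsub hs) (by positivity)).symm
      exact ⟨_, h3, hA₂ ▸ hfin _ _ h3 h1⟩
    · obtain ⟨c, hc0, h1⟩ := hrec (hcrit hc)
      exact ⟨c, hc0, hB₂ ▸ hfin _ _ hc0 (by simpa using h1)⟩
    · have hκ : κ₂ = 0 := hκ₂ ▸ halfGap_eq_zero hl
      have h1 := hv.tendsto_div_id (by simpa [hκ] using hv1) hu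
      rw [← hW₀] at h1
      have h2 : 0 ≤ W₀ := ge_of_tendsto h1 (by
        filter_upwards [eventually_gt_atTop 0] with t ht using (div_pos (hzp _) ht).le)
      have h3 : 0 < W₀ := lt_of_le_of_ne h2 (hsub hs).symm
      refine ⟨W₀, h3, ?_⟩
      rw [hA0, ← Real.tendsto_comp_exp_atTop]
      have := h1.div_const W₀
      rw [div_self h3.ne'] at this
      refine this.congr fun t => ?_
      rw [mul_comm W₀, ← div_div, ← div_div, div_exp_rpow, hUexp, Real.log_exp]
      simp
    · have hκ : κ₂ = 0 := hκ₂ ▸ halfGap_eq_zero hl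
      obtain ⟨c, hc0, h1⟩ := hrec (hcrit hc)
      exact ⟨c, hc0, hA0 ▸ hfin 0 c hc0 (by simpa [hκ] using h1)⟩
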